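/- Let $M$ be a compact connected oriented smooth $3$-manifold with non-empty boundary. Let $\hat M$ be the space obtained from $M$ by collapsing each connected component of $\partial M$ to a point, and let $V\subset\hat M$ be the set of these points. Let $T$ be an ideal triangulation of $\hat M$: a realization of $\hat M$ by finitely many abstract tetrahedra whose $2$-faces are glued in pairs by affine isomorphisms (self and multiple adjacencies being allowed, no face remaining unglued), such that the set of vertices of $T$ is $V$. Let $\Sigma$ be the $2$-skeleton of the dual cell decomposition of $T$. Its open $2$-cells (regions) are dual to the edges of $T$, the open $1$-cells of its singular set are dual to the $2$-faces of $T$, and its $0$-cells, at each of which four branches of $1$-cells meet, are dual to the tetrahedra. A branching $b$ on $T$ is a system of orientations of the edges of $T$ which on every abstract tetrahedron of $T$ is induced by a total order of the vertices, every edge going towards its bigger endpoint. A pre-branching on $T$ is a system of orientations of the open $1$-cells of the singular set of $\Sigma$ such that at every $0$-cell two branches are ingoing and two are outgoing. A branching $b$ induces a pre-branching $\omega_b$ as follows: orient every region of $\Sigma$ so that its dual $b$-oriented edge meets it with intersection number $1$; then at every $1$-cell of the singular set the three incident local branches of regions do not all induce the same orientation, and $\omega_b$ gives the $1$-cell the prevailing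 orientation, induced by two of the three. Assume that $H_2(M;\mathbb{Z})=0$. If $b$ and $b'$ are branchings on the same ideal triangulation $T$ of $\hat M$ such that $\omega_b=\omega_{b'}$, then $b=b'$. -/

import Mathlib

open CategoryTheory CategoryTheory.Limits
open scoped Manifold ContDiff

universe u v

/-- A finite family `ι` of abstract tetrahedra, each with vertices `0, 1, 2, 3`, whose abstract
`2`-faces are glued in pairs, so that no face remains unglued.  The face `(t, i)` is the face of
the tetrahedron `t` opposite to the vertex `i`.  It is glued to a face of `nbr t i` by the affine
map given on the vertices by the permutation `perm t i`, restricted to the three `j ≠ i`; the value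
`perm t i i` is then the vertex opposite to the target face, so the target face is
`(nbr t i, perm t i i)`.  Self adjacencies and multiple adjacencies of tetrahedra are allowed. -/
structure FaceGluing (ι : Type v) where
  nbr : ι → Fin 4 → ι
  perm : ι → Fin 4 → Equiv.Perm (Fin 4)
  nbr_nbr : ∀ t i, nbr (nbr t i) (perm t i i) = t
  perm_perm : ∀ t i, perm (nbr t i) (perm t i i) = (perm t i)⁻¹
  ne_self : ∀ t i, (nbr t i, perm t i i) ≠ (t, i)

namespace FaceGluing

variable {ι : Type v} (T : FaceGluing ι)

/-- Points of the disjoint union of the tetrahedra (in barycentric coordinates) that are identified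
by one of the face gluings. -/
def GlueRel (p q : Σ _ : ι, stdSimplex ℝ (Fin 4)) : Prop :=
  ∃ i : Fin 4, p.2 i = 0 ∧ q.1 = T.nbr p.1 i ∧ ∀ j, q.2 (T.perm p.1 i j) = p.2 j

/-- The polyhedron of the triangulation, with the quotient topology. -/
def Realization : Type v := Quot T.GlueRel

instance : TopologicalSpace T.Realization :=
  inferInstanceAs (TopologicalSpace (Quot T.GlueRel))

/-- The set of vertices of the triangulation. -/
def vertices : Set T.Realization :=
  {p | ∃ (t : ι) (x : stdSimplex ℝ (Fin 4)) (i : Fin 4), x i = 1 ∧ p = Quot.mk T.GlueRel ⟨t, x⟩}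

/-- A coherent orientation: `sgn t = 1` if the orientation of the tetrahedron `t` is the one given
by the order `0, 1, 2, 3` of its vertices, `sgn t = -1` otherwise, and all face gluings reverse
the orientations induced on the faces. -/
structure Orientation where
  sgn : ι → ℤˣ
  coherent : ∀ t i, sgn (T.nbr t i) = - (sgn t * Equiv.Perm.sign (T.perm t i))

/-- A branching: an orientation of the edges of the triangulation, given as a system of
orientations of the edges of the abstract tetrahedra (`pos t j k` says that the edge with endpoints
`j`, `k` of `t` is oriented from `j` to `k`) that is compatible with the gluings and that on every
tetrahedron is induced by a total order of the four vertices, edges going towards the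
bigger endpoint. -/
@[ext]
structure Branching where
  pos : ι → Fin 4 → Fin 4 → Prop
  pos_perm : ∀ t i j k, j ≠ i → k ≠ i →
    (pos (T.nbr t i) (T.perm t i j) (T.perm t i k) ↔ pos t j k)
  exists_order : ∀ t, ∃ ρ : Equiv.Perm (Fin 4), ∀ j k, pos t j k ↔ ρ j < ρ k

/-- A pre-branching: a system of orientations of the edges of the singular set of the dual spine
(that is, of transverse orientations of the `2`-faces), such that at every vertex of the dual spine
two of the four branches are outgoing and two are ingoing.  Here `out t i` says that the edge dual
to the face `(t, i)` goes out of the tetrahedron `t` through this face. -/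
@[ext]
structure PreBranching where
  out : ι → Fin 4 → Prop
  out_perm : ∀ t i, out (T.nbr t i) (T.perm t i i) ↔ ¬ out t i
  two_out : ∀ t, {i | out t i}.ncard = 2

variable {T}

/-- Every ordered pair of vertices of the face `(t, i)` is `(σ 0, σ 1)` for exactly one permutation
`σ` with `σ 3 = i`.  If the edge of `t` with endpoints `σ 0`, `σ 1` is oriented from `σ 0` to `σ 1`
and its dual region is oriented so that the edge meets it with intersection number `1`, then the
region induces on the edge dual to the face `(t, i)` the direction of the right-handed normal to
the face oriented by `σ 0, σ 1, σ 2`.  This normal goes out of `t` if and only if `σ 0, σ 1, σ 2, i`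
is a negative order of the vertices of `t`.  So this is the set of the edges of the face `(t, i)`
whose dual regions induce the sign `s` on the dual edge of the face,
where `s = -1` stands for outgoing and `s = 1` for ingoing. -/
def Branching.inducing (b : T.Branching) (o : T.Orientation) (s : ℤˣ) (t : ι) (i : Fin 4) :
    Set (Equiv.Perm (Fin 4)) :=
  {σ | σ 3 = i ∧ b.pos t (σ 0) (σ 1) ∧ o.sgn t * Equiv.Perm.sign σ = s}

/-- Inducing sets in terms of an ordering of the vertices of the tetrahedron. -/
theorem Branching.ncard_inducing (b : T.Branching) (o : T.Orientation) (s : ℤˣ) (t : ι)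
    (ρ : Equiv.Perm (Fin 4)) (hρ : ∀ j k, b.pos t j k ↔ ρ j < ρ k) (i : Fin 4) :
    (b.inducing o s t i).ncard =
      (Finset.univ.filter fun σ : Equiv.Perm (Fin 4) => σ 3 = ρ i ∧ σ 0 < σ 1 ∧
        Equiv.Perm.sign σ = s * o.sgn t * Equiv.Perm.sign ρ).card := by
  rw [← Set.ncard_coe_finset]
  refine Set.ncard_congr (fun σ _ => ρ * σ) ?_ ?_ ?_
  · rintro σ ⟨h1, h2, h3⟩
    simp only [Finset.coe_filter, Finset.mem_univ, true_and, Set.mem_ofPred_eq,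
      Equiv.Perm.mul_apply, Equiv.Perm.sign_mul]
    refine ⟨by rw [h1], (hρ _ _).1 h2, ?_⟩
    rw [← h3]
    rcases Int.units_eq_one_or (o.sgn t) with h | h <;> simp [h, mul_comm]
  · intro σ τ _ _ h
    exact mul_left_cancel h
  · intro σ hσ
    simp only [Finset.coe_filter, Finset.mem_univ, true_and, Set.mem_ofPred_eq] at hσ
    refine ⟨ρ⁻¹ * σ, ⟨?_, ?_, ?_⟩, by simp⟩
    · simp [hσ.1]
    · rw [hρ]; simpa using hσ.2.1
    · rw [Equiv.Perm.sign_mul, hσ.2.2, Equiv.Perm.sign_inv]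
      rcases Int.units_eq_one_or (o.sgn t) with h | h <;>
      rcases Int.units_eq_one_or (Equiv.Perm.sign ρ) with h' | h' <;> simp [h, h']

theorem Branching.ncard_inducing_add (b : T.Branching) (o : T.Orientation) (t : ι) (i : Fin 4) :
    (b.inducing o (-1) t i).ncard + (b.inducing o 1 t i).ncard = 3 := by
  obtain ⟨ρ, hρ⟩ := b.exists_order t
  rw [b.ncard_inducing o _ t ρ hρ, b.ncard_inducing o _ t ρ hρ]
  generalize ρ i = k
  rcases Int.units_eq_one_or (o.sgn t) with h | h <;>
  rcases Int.units_eq_one_or (Equiv.Perm.sign ρ) with h' | h' <;> rw [h, h'] <;>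
  revert k <;> decide

theorem Branching.ncard_inducing_perm (b : T.Branching) (o : T.Orientation) (s : ℤˣ)
    (t : ι) (i : Fin 4) :
    (b.inducing o s (T.nbr t i) (T.perm t i i)).ncard = (b.inducing o (-s) t i).ncard := by
  symm
  have key : ∀ σ : Equiv.Perm (Fin 4), T.perm t i * σ ∈ b.inducing o s (T.nbr t i) (T.perm t i i) ↔
      σ ∈ b.inducing o (-s) t i := by
    intro σ
    simp only [Branching.inducing, Set.mem_ofPred_eq, Equiv.Perm.mul_apply, Equiv.Perm.sign_mul,
      EmbeddingLike.apply_eq_iff_eq]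
    refine and_congr_right fun h => ?_
    refine and_congr (b.pos_perm t i _ _ ?_ ?_) ?_
    · rw [← h]; simp
    · rw [← h]; simp
    · rw [o.coherent]
      rcases Int.units_eq_one_or (Equiv.Perm.sign (T.perm t i)) with h' | h' <;>
      simp [h', neg_eq_iff_eq_neg]
  refine Set.ncard_congr (fun σ _ => T.perm t i * σ) (fun σ hσ => (key σ).2 hσ)
    (fun σ τ _ _ h => mul_left_cancel h) (fun σ hσ => ⟨(T.perm t i)⁻¹ * σ, ?_, by simp⟩)
  rw [← key]
  simpa using hσ

/-- The pre-branching `ω_b` induced by a branching `b` of an oriented triangulation: the edge dual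
to a `2`-face carries the prevailing orientation, namely the one induced by at least two of the
three incident regions. -/
def Branching.toPreBranching (b : T.Branching) (o : T.Orientation) : T.PreBranching where
  out t i := 2 ≤ (b.inducing o (-1) t i).ncard
  out_perm t i := by
    have h1 := b.ncard_inducing_perm o (-1) t i
    have h2 := b.ncard_inducing_add o t i
    rw [neg_neg] at h1
    omega
  two_out t := by
    obtain ⟨ρ, hρ⟩ := b.exists_order t
    have h : ∀ s : ℤˣ, ((Finset.univ : Finset (Fin 4)).filter fun k => 2 ≤
        (Finset.univ.filter fun σ : Equiv.Perm (Fin 4) => σ 3 = k ∧ σ 0 < σ 1 ∧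
          Equiv.Perm.sign σ = s).card).card = 2 := by
      intro s
      rcases Int.units_eq_one_or s with h | h <;> subst h <;> decide
    refine Eq.trans ?_ (h (-1 * o.sgn t * Equiv.Perm.sign ρ))
    rw [← Set.ncard_coe_finset]
    refine Set.ncard_congr (fun i _ => ρ i) ?_ (fun i j _ _ hij => ρ.injective hij) ?_
    · intro i hi
      simpa [b.ncard_inducing o (-1) t ρ hρ] using hi
    · intro k hk
      refine ⟨ρ.symm k, ?_, by simp⟩
      simpa [b.ncard_inducing o (-1) t ρ hρ] using hk

end FaceGluing

section Manifold

variable (M : Type u) [TopologicalSpace M] [ChartedSpace (EuclideanHalfSpace 3) M]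

/-- Two points are identified if they are equal or lie on the same connected component of the
boundary. -/
def boundarySetoid : Setoid M where
  r x y := x = y ∨ (x ∈ (𝓡∂ 3).boundary M ∧ y ∈ (𝓡∂ 3).boundary M ∧
    connectedComponentIn ((𝓡∂ 3).boundary M) x = connectedComponentIn ((𝓡∂ 3).boundary M) y)
  iseqv :=
    { refl := fun _ => Or.inl rfl
      symm := by
        rintro x y (h | ⟨hx, hy, h⟩)
        · exact Or.inl h.symm
        · exact Or.inr ⟨hy, hx, h.symm⟩
      trans := by
        rintro x y z (rfl | ⟨hx, hy, h⟩) (rfl | ⟨hy', hz, h'⟩)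
        · exact Or.inl rfl
        · exact Or.inr ⟨hy', hz, h'⟩
        · exact Or.inr ⟨hx, hy, h⟩
        · exact Or.inr ⟨hx, hz, h.trans h'⟩ }

/-- The space obtained from `M` by collapsing each boundary component to a point, with the
quotient topology. -/
def CollapsedBoundary : Type u := Quotient (boundarySetoid M)

instance : TopologicalSpace (CollapsedBoundary M) :=
  inferInstanceAs (TopologicalSpace (Quotient (boundarySetoid M)))

/-- The set of the points to which the boundary components are collapsed. -/
def collapsedPoints : Set (CollapsedBoundary M) :=
  Quotient.mk (boundarySetoid M) '' (𝓡∂ 3).boundary M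

/-- The triangulation with gluing data `T`, together with a homeomorphism of its polyhedron onto
the space obtained by collapsing the boundary components of `M`, such that the vertices are
exactly the points to which the boundary components are collapsed. -/
structure IdealTriangulation (ι : Type v) where
  gluing : FaceGluing ι
  homeo : gluing.Realization ≃ₜ CollapsedBoundary M
  image_vertices : homeo '' gluing.vertices = collapsedPoints M

end Manifold

/-- The singular homology group `H_n(X; ℤ)`. -/
noncomputable def integralHomology (n : ℕ) (X : Type u) [TopologicalSpace X] : ModuleCat.{u} ℤ :=
  ((AlgebraicTopology.singularHomologyFunctor (ModuleCat.{u} ℤ) n).obj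
    (ModuleCat.of ℤ (ULift.{u} ℤ))).obj (TopCat.of X)

/-! Orient the regions of the dual spine Σ by a branching `b` and add them up to a cellular 2-chain.
At every 1-cell of the singular set the three incident contributions stand two against one, so the
boundary of this chain has coefficient ±1 there, with the sign recorded by ω_b. If ω_b = ω_b', the
difference of the two chains is therefore a 2-cycle. Since M retracts onto Σ and Σ has no 3-cells,
H₂(M) = 0 forces this cycle to vanish region by region, so b and b' agree on every edge.

The proof below replaces the retraction by a direct computation with singular chains. The regions
are cut into triangles spanned by the barycenters of a tetrahedron, one of its faces and one of its
edges. These avoid the vertices, so they lift to the interior of M (`exists_lift`), and weighted by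
the difference of the two branchings they form a singular cycle (`sum_sign_eq`,
`sum_singularFace_eq_zero`).

A coefficient is read off by intersecting with an arc that runs parallel to an edge of the
triangulation. The arc is encoded by a labelling with 0, 1, 2, 3: it is the locus where the labels
0, 1, 2 meet, and away from the vertices every point has a neighbourhood missing some label
(`eventually_label_ne`). As in Sperner's lemma, the signed number of triangles labelled 0, 1, 2 in a
sufficiently fine barycentric subdivision vanishes on boundaries (`eventually_labelCount_boundary`).
It is -1 on the triangles met by the arc and eventually 0 on all others. To label the boundary of M
too, M is first mapped into its interior by a map fixing the triangles of the cycle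
(`exists_continuousMap_interior`). -/

/-! ### Barycenters in a simplex and their distances. -/

namespace stdSimplex

variable {α β : Type*} [Fintype α] [Fintype β]

/-- The center of gravity of a tuple of points of a standard simplex. -/
noncomputable def center {k : ℕ} (v : Fin (k + 1) → stdSimplex ℝ α) : stdSimplex ℝ α :=
  ⟨∑ i, (k + 1 : ℝ)⁻¹ • (v i : α → ℝ), by
    refine (convex_stdSimplex ℝ α).sum_mem (fun _ _ => by positivity) ?_ fun i _ => (v i).2
    simp [mul_inv_cancel₀ (by positivity : (k + 1 : ℝ) ≠ 0)]⟩

theorem coe_center {k : ℕ} (v : Fin (k + 1) → stdSimplex ℝ α) :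
    (center v : α → ℝ) = ∑ i, (k + 1 : ℝ)⁻¹ • (v i : α → ℝ) := rfl

theorem map_center (f : α → β) {k : ℕ} (v : Fin (k + 1) → stdSimplex ℝ α) :
    map f (center v) = center (fun i => map f (v i)) := by
  ext x
  simp only [map_coe, coe_center, map_sum, map_smul]

theorem dist_center_le {k : ℕ} (v : Fin (k + 1) → stdSimplex ℝ α) (p : stdSimplex ℝ α) {r : ℝ}
    (h : ∀ i, dist (v i) p ≤ r) : dist (center v) p ≤ r := by
  have := (convex_closedBall (p : α → ℝ) r).sum_mem (t := Finset.univ)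
    (w := fun _ : Fin (k + 1) => (k + 1 : ℝ)⁻¹) (z := fun i => (v i : α → ℝ))
    (fun _ _ => by positivity)
    (by simp [mul_inv_cancel₀ (by positivity : (k + 1 : ℝ) ≠ 0)])
    (fun i _ => h i)
  exact this

/-- The center of gravity of `k + 1` points of mutual distances at most `r` has distance at most
`k / (k + 1) * r` from these points. -/
theorem dist_center_self_le {k : ℕ} (v : Fin (k + 1) → stdSimplex ℝ α) {r : ℝ}
    (h : ∀ i j, dist (v i) (v j) ≤ r) (j : Fin (k + 1)) :
    dist (v j) (center v) ≤ k / (k + 1) * r := by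
  have hk : (k + 1 : ℝ) ≠ 0 := by positivity
  have e : (v j : α → ℝ) - center v = ∑ i, (k + 1 : ℝ)⁻¹ • ((v j : α → ℝ) - v i) := by
    rw [coe_center]
    simp only [smul_sub, Finset.sum_sub_distrib]
    congr 1
    simp only [Finset.sum_const, Finset.card_univ, Fintype.card_fin]
    rw [← Nat.cast_smul_eq_nsmul ℝ, smul_smul]
    push_cast
    rw [mul_inv_cancel₀ hk, one_smul]
  change dist (v j : α → ℝ) (center v : α → ℝ) ≤ _
  rw [dist_eq_norm, e]
  refine (norm_sum_le _ _).trans ?_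
  rw [Fin.sum_univ_succAbove _ j]
  simp only [sub_self, smul_zero, norm_zero, zero_add]
  refine (Finset.sum_le_card_nsmul _ _ ((k + 1 : ℝ)⁻¹ * r) fun i _ => ?_).trans (le_of_eq ?_)
  · rw [norm_smul, Real.norm_of_nonneg (by positivity), ← dist_eq_norm]
    exact mul_le_mul_of_nonneg_left (h _ _) (by positivity)
  · simp only [Finset.card_univ, Fintype.card_fin, nsmul_eq_mul]
    field_simp

end stdSimplex

/-! ### Barycentric subdivision of cochains. -/

namespace SubdividedCochain

open stdSimplex

variable {α β : Type*} [Fintype α] [Fintype β]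

/-- The barycentric subdivision of a `1`-cochain on pairs of points. -/
noncomputable def sd₁ (ψ : stdSimplex ℝ α → stdSimplex ℝ α → ℤ) (x y : stdSimplex ℝ α) : ℤ :=
  ψ (center ![x, y]) y - ψ (center ![x, y]) x

/-- The barycentric subdivision of a `2`-cochain on triples of points. -/
noncomputable def sd₂ (ψ : stdSimplex ℝ α → stdSimplex ℝ α → stdSimplex ℝ α → ℤ)
    (x y z : stdSimplex ℝ α) : ℤ :=
  sd₁ (ψ (center ![x, y, z])) y z - sd₁ (ψ (center ![x, y, z])) x z +
    sd₁ (ψ (center ![x, y, z])) x y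

/-- The barycentric subdivision of a `3`-cochain on quadruples of points. -/
noncomputable def sd₃
    (ψ : stdSimplex ℝ α → stdSimplex ℝ α → stdSimplex ℝ α → stdSimplex ℝ α → ℤ)
    (x y z w : stdSimplex ℝ α) : ℤ :=
  sd₂ (ψ (center ![x, y, z, w])) y z w - sd₂ (ψ (center ![x, y, z, w])) x z w +
    sd₂ (ψ (center ![x, y, z, w])) x y w - sd₂ (ψ (center ![x, y, z, w])) x y z

/-- The coboundary of a `2`-cochain. -/
def coboundary {P : Type*} (ψ : P → P → P → ℤ) (x y z w : P) : ℤ :=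
  ψ y z w - ψ x z w + ψ x y w - ψ x y z

/-- Subdivision is a chain map: the faces of the cones that contain the apex cancel, because the
boundary of a boundary is zero, and the subdivided faces of the tetrahedron remain. -/
theorem coboundary_sd₂ (ψ : stdSimplex ℝ α → stdSimplex ℝ α → stdSimplex ℝ α → ℤ) :
    coboundary (sd₂ ψ) = sd₃ (coboundary ψ) := by
  ext x y z w
  simp only [coboundary, sd₂, sd₃, sd₁]
  ring

theorem coboundary_iterate_sd₂ (ψ : stdSimplex ℝ α → stdSimplex ℝ α → stdSimplex ℝ α → ℤ)
    (m : ℕ) : coboundary (sd₂^[m] ψ) = sd₃^[m] (coboundary ψ) := by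
  induction m generalizing ψ with
  | zero => rfl
  | succ m ih => rw [Function.iterate_succ_apply, Function.iterate_succ_apply, ih, coboundary_sd₂]

/-- Affine maps preserve barycenters, so subdivision is natural. This is applied to the face
inclusions of a tetrahedron. -/
theorem sd₂_map (f : α → β)
    (ψ : stdSimplex ℝ β → stdSimplex ℝ β → stdSimplex ℝ β → ℤ) :
    sd₂ (fun x y z => ψ (map f x) (map f y) (map f z)) =
      fun x y z => sd₂ ψ (map f x) (map f y) (map f z) := by
  ext x y z
  have e2 : ∀ x y, map f (center ![x, y]) = center ![map f x, map f y] := fun x y => by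
    rw [map_center]; congr 1; ext1 i; fin_cases i <;> rfl
  have e3 : map f (center ![x, y, z]) = center ![map f x, map f y, map f z] := by
    rw [map_center]; congr 1; ext1 i; fin_cases i <;> rfl
  simp only [sd₂, sd₁, e2, e3]

theorem iterate_sd₂_map (f : α → β)
    (ψ : stdSimplex ℝ β → stdSimplex ℝ β → stdSimplex ℝ β → ℤ) (m : ℕ) :
    sd₂^[m] (fun x y z => ψ (map f x) (map f y) (map f z)) =
      fun x y z => sd₂^[m] ψ (map f x) (map f y) (map f z) := by
  induction m generalizing ψ with
  | zero => rfl
  | succ m ih => rw [Function.iterate_succ_apply, sd₂_map, ih, Function.iterate_succ_apply]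

/-- The factor k / (k + 1) is at most 3 / 4 for k ≤ 3, so one contraction constant serves edges,
triangles and tetrahedra. -/
theorem dist_center₂ {x y : stdSimplex ℝ α} {r : ℝ} (h : dist x y ≤ r) :
    dist x (center ![x, y]) ≤ 3 / 4 * r ∧ dist y (center ![x, y]) ≤ 3 / 4 * r := by
  have h0 : 0 ≤ r := dist_nonneg.trans h
  have := dist_center_self_le ![x, y] (r := r) (by
    intro i j; fin_cases i <;> fin_cases j <;> simp [h, h0, dist_comm y x])
  refine ⟨(this 0).trans ?_, (this 1).trans ?_⟩ <;> norm_num <;> nlinarith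

theorem dist_center₃ {x y z : stdSimplex ℝ α} {r : ℝ} (hxy : dist x y ≤ r) (hxz : dist x z ≤ r)
    (hyz : dist y z ≤ r) :
    dist x (center ![x, y, z]) ≤ 3 / 4 * r ∧ dist y (center ![x, y, z]) ≤ 3 / 4 * r ∧
      dist z (center ![x, y, z]) ≤ 3 / 4 * r := by
  have h0 : 0 ≤ r := dist_nonneg.trans hxy
  have := dist_center_self_le ![x, y, z] (r := r) (by
    intro i j
    fin_cases i <;> fin_cases j <;> simp [hxy, hxz, hyz, h0, dist_comm y x, dist_comm z x,
      dist_comm z y])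
  refine ⟨(this 0).trans ?_, (this 1).trans ?_, (this 2).trans ?_⟩ <;> norm_num <;> nlinarith

theorem dist_center₄ {x y z w : stdSimplex ℝ α} {r : ℝ} (hxy : dist x y ≤ r) (hxz : dist x z ≤ r)
    (hxw : dist x w ≤ r) (hyz : dist y z ≤ r) (hyw : dist y w ≤ r) (hzw : dist z w ≤ r) :
    dist x (center ![x, y, z, w]) ≤ 3 / 4 * r ∧ dist y (center ![x, y, z, w]) ≤ 3 / 4 * r ∧
      dist z (center ![x, y, z, w]) ≤ 3 / 4 * r ∧ dist w (center ![x, y, z, w]) ≤ 3 / 4 * r := by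
  have h0 : 0 ≤ r := dist_nonneg.trans hxy
  have := dist_center_self_le ![x, y, z, w] (r := r) (by
    intro i j
    fin_cases i <;> fin_cases j <;> simp [hxy, hxz, hyz, hxw, hyw, hzw, h0, dist_comm y x,
      dist_comm z x, dist_comm z y, dist_comm w x, dist_comm w y, dist_comm w z])
  refine ⟨(this 0).trans ?_, (this 1).trans ?_, (this 2).trans ?_, (this 3).trans ?_⟩ <;>
    norm_num

theorem dist_center₂_le {x y p : stdSimplex ℝ α} {r : ℝ} (hx : dist x p ≤ r) (hy : dist y p ≤ r) :
    dist (center ![x, y]) p ≤ r :=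
  dist_center_le _ _ fun i => by fin_cases i <;> assumption

theorem dist_center₃_le {x y z p : stdSimplex ℝ α} {r : ℝ} (hx : dist x p ≤ r)
    (hy : dist y p ≤ r) (hz : dist z p ≤ r) : dist (center ![x, y, z]) p ≤ r :=
  dist_center_le _ _ fun i => by fin_cases i <;> assumption

/-- A `2`-cochain vanishing on triples of mutual distances at most `r`. -/
def Small₂ (r : ℝ) (ψ : stdSimplex ℝ α → stdSimplex ℝ α → stdSimplex ℝ α → ℤ) : Prop :=
  ∀ x y z, dist x y ≤ r → dist x z ≤ r → dist y z ≤ r → ψ x y z = 0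

/-- A `3`-cochain vanishing on quadruples of mutual distances at most `r`. -/
def Small₃ (r : ℝ)
    (ψ : stdSimplex ℝ α → stdSimplex ℝ α → stdSimplex ℝ α → stdSimplex ℝ α → ℤ) : Prop :=
  ∀ x y z w, dist x y ≤ r → dist x z ≤ r → dist x w ≤ r → dist y z ≤ r → dist y w ≤ r →
    dist z w ≤ r → ψ x y z w = 0

/-- The subdivision of a triangle with sides at most `r` at a point at distance at most `3 / 4 * r`
from its vertices has sides at most `3 / 4 * r`. -/
theorem sd₁_eq_zero {r : ℝ} {χ : stdSimplex ℝ α → stdSimplex ℝ α → ℤ} {p x y : stdSimplex ℝ α}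
    (hχ : ∀ x y, dist x p ≤ 3 / 4 * r → dist y p ≤ 3 / 4 * r → dist x y ≤ 3 / 4 * r → χ x y = 0)
    (hx : dist x p ≤ 3 / 4 * r) (hy : dist y p ≤ 3 / 4 * r) (hxy : dist x y ≤ r) :
    sd₁ χ x y = 0 := by
  obtain ⟨h1, h2⟩ := dist_center₂ hxy
  have h := dist_center₂_le hx hy
  rw [sd₁, hχ _ _ h hx (by rwa [dist_comm]), hχ _ _ h hy (by rwa [dist_comm]), sub_self]

/-- The cochain is evaluated only on triangles of the subdivision, whose sides have shrunk by the
factor 3 / 4. -/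
theorem Small₂.sd₂ {r : ℝ} {ψ : stdSimplex ℝ α → stdSimplex ℝ α → stdSimplex ℝ α → ℤ}
    (h : Small₂ (3 / 4 * r) ψ) : Small₂ r (sd₂ ψ) := by
  intro x y z hxy hxz hyz
  obtain ⟨h1, h2, h3⟩ := dist_center₃ hxy hxz hyz
  have key : ∀ a b, dist a (center ![x, y, z]) ≤ 3 / 4 * r →
      dist b (center ![x, y, z]) ≤ 3 / 4 * r → dist a b ≤ r →
      sd₁ (ψ (center ![x, y, z])) a b = 0 := fun a b ha hb hab =>
    sd₁_eq_zero (fun a b ha hb hab => h _ _ _ (by rwa [dist_comm]) (by rwa [dist_comm]) hab)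
      ha hb hab
  rw [SubdividedCochain.sd₂, key _ _ h2 h3 hyz, key _ _ h1 h3 hxz, key _ _ h1 h2 hxy]
  rfl

theorem Small₃.sd₃ {r : ℝ}
    {ψ : stdSimplex ℝ α → stdSimplex ℝ α → stdSimplex ℝ α → stdSimplex ℝ α → ℤ}
    (h : Small₃ (3 / 4 * r) ψ) : Small₃ r (sd₃ ψ) := by
  intro x y z w hxy hxz hxw hyz hyw hzw
  obtain ⟨h1, h2, h3, h4⟩ := dist_center₄ hxy hxz hxw hyz hyw hzw
  set p := center ![x, y, z, w]
  have key : ∀ a b c, dist a p ≤ 3 / 4 * r → dist b p ≤ 3 / 4 * r → dist c p ≤ 3 / 4 * r →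
      dist a b ≤ r → dist a c ≤ r → dist b c ≤ r → SubdividedCochain.sd₂ (ψ p) a b c = 0 := by
    intro a b c ha hb hc hab hac hbc
    obtain ⟨g1, g2, g3⟩ := dist_center₃ hab hac hbc
    have gp := dist_center₃_le ha hb hc
    have key' : ∀ d e, dist d p ≤ 3 / 4 * r → dist e p ≤ 3 / 4 * r →
        dist d (center ![a, b, c]) ≤ 3 / 4 * r →
        dist e (center ![a, b, c]) ≤ 3 / 4 * r → dist d e ≤ r →
        sd₁ (ψ p (center ![a, b, c])) d e = 0 := by
      intro d e hd he hd' he' hde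
      obtain ⟨k1, k2⟩ := dist_center₂ hde
      have k := dist_center₂_le hd he
      have k' := dist_center₂_le hd' he'
      rw [dist_comm] at k k' hd he hd' he' gp k1 k2
      rw [sd₁, h _ _ _ _ gp k hd k' hd' k1, h _ _ _ _ gp k he k' he' k2, sub_self]
    rw [SubdividedCochain.sd₂, key' _ _ hb hc g2 g3 hbc, key' _ _ ha hc g1 g3 hac,
      key' _ _ ha hb g1 g2 hab]
    rfl
  rw [SubdividedCochain.sd₃, key _ _ _ h2 h3 h4 hyz hyw hzw, key _ _ _ h1 h3 h4 hxz hxw hzw,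
    key _ _ _ h1 h2 h4 hxy hxw hyw, key _ _ _ h1 h2 h3 hxy hxz hyz]
  rfl

theorem Small₂.iterate_sd₂ {ψ : stdSimplex ℝ α → stdSimplex ℝ α → stdSimplex ℝ α → ℤ} (m : ℕ)
    {r : ℝ} (h : Small₂ ((3 / 4) ^ m * r) ψ) : Small₂ r (SubdividedCochain.sd₂^[m] ψ) := by
  induction m generalizing ψ with
  | zero => simpa using h
  | succ m ih =>
    rw [Function.iterate_succ_apply]
    exact ih (Small₂.sd₂ (by rwa [← mul_assoc, ← pow_succ']))

theorem Small₃.iterate_sd₃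
    {ψ : stdSimplex ℝ α → stdSimplex ℝ α → stdSimplex ℝ α → stdSimplex ℝ α → ℤ} (m : ℕ)
    {r : ℝ} (h : Small₃ ((3 / 4) ^ m * r) ψ) : Small₃ r (SubdividedCochain.sd₃^[m] ψ) := by
  induction m generalizing ψ with
  | zero => simpa using h
  | succ m ih =>
    rw [Function.iterate_succ_apply]
    exact ih (Small₃.sd₃ (by rwa [← mul_assoc, ← pow_succ']))

theorem dist_le_one (x y : stdSimplex ℝ α) : dist x y ≤ 1 :=
  (Metric.dist_le_diam_of_mem (bounded_stdSimplex _) x.2 y.2).trans diam_stdSimplex_le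

theorem exists_pow_le {r : ℝ} (hr : 0 < r) : ∃ m₀ : ℕ, ∀ m ≥ m₀, (3 / 4 : ℝ) ^ m * 1 ≤ r := by
  obtain ⟨m₀, h⟩ := exists_pow_lt_of_lt_one hr (by norm_num : (3 / 4 : ℝ) < 1)
  refine ⟨m₀, fun m hm => ?_⟩
  rw [mul_one]
  exact (pow_le_pow_of_le_one (by norm_num) (by norm_num) hm).trans h.le

/-- All distances in the simplex are at most 1, so after m subdivisions the cochain is evaluated on
triples of mutual distances at most (3 / 4) ^ m. -/
theorem eventually_iterate_sd₂_eq_zero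
    {ψ : stdSimplex ℝ α → stdSimplex ℝ α → stdSimplex ℝ α → ℤ} {r : ℝ} (hr : 0 < r)
    (h : Small₂ r ψ) (x y z : stdSimplex ℝ α) : ∃ m₀, ∀ m ≥ m₀, sd₂^[m] ψ x y z = 0 := by
  obtain ⟨m₀, hm⟩ := exists_pow_le hr
  refine ⟨m₀, fun m hm' => Small₂.iterate_sd₂ m (r := 1) ?_ _ _ _ (dist_le_one _ _)
    (dist_le_one _ _) (dist_le_one _ _)⟩
  exact fun x y z h1 h2 h3 => h x y z (h1.trans (hm m hm')) (h2.trans (hm m hm'))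
    (h3.trans (hm m hm'))

theorem eventually_iterate_sd₃_eq_zero
    {ψ : stdSimplex ℝ α → stdSimplex ℝ α → stdSimplex ℝ α → stdSimplex ℝ α → ℤ} {r : ℝ}
    (hr : 0 < r) (h : Small₃ r ψ) (x y z w : stdSimplex ℝ α) :
    ∃ m₀, ∀ m ≥ m₀, sd₃^[m] ψ x y z w = 0 := by
  obtain ⟨m₀, hm⟩ := exists_pow_le hr
  refine ⟨m₀, fun m hm' => Small₃.iterate_sd₃ m (r := 1) ?_ _ _ _ _ (dist_le_one _ _)
    (dist_le_one _ _) (dist_le_one _ _) (dist_le_one _ _) (dist_le_one _ _) (dist_le_one _ _)⟩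
  exact fun x y z w h1 h2 h3 h4 h5 h6 => h x y z w (h1.trans (hm m hm')) (h2.trans (hm m hm'))
    (h3.trans (hm m hm')) (h4.trans (hm m hm')) (h5.trans (hm m hm')) (h6.trans (hm m hm'))

/-- A cocycle that vanishes on the three sides of a triangle takes the same value on the triangle
and on its subdivision. -/
theorem iterate_sd₂_eq {ψ : stdSimplex ℝ (Fin 3) → stdSimplex ℝ (Fin 3) → stdSimplex ℝ (Fin 3) → ℤ}
    (hψ : coboundary ψ = 0) (h : ∀ x y z i, x i = 0 → y i = 0 → z i = 0 → ψ x y z = 0) (m : ℕ) :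
    sd₂^[m] ψ (vertex 0) (vertex 1) (vertex 2) = ψ (vertex 0) (vertex 1) (vertex 2) := by
  have hc : ∀ x y (i : Fin 3), x i = 0 → y i = 0 → center ![x, y] i = 0 := by
    intro x y i hx hy
    have hx' : (x : Fin 3 → ℝ) i = 0 := hx
    have hy' : (y : Fin 3 → ℝ) i = 0 := hy
    simp [coe_center, Fin.sum_univ_two, hx', hy']
  have hc3 : ∀ x y z (i : Fin 3), x i = 0 → y i = 0 → z i = 0 → center ![x, y, z] i = 0 := by
    intro x y z i hx hy hz
    have hx' : (x : Fin 3 → ℝ) i = 0 := hx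
    have hy' : (y : Fin 3 → ℝ) i = 0 := hy
    have hz' : (z : Fin 3 → ℝ) i = 0 := hz
    simp [coe_center, Fin.sum_univ_three, hx', hy', hz']
  have step : ∀ (ψ : stdSimplex ℝ (Fin 3) → stdSimplex ℝ (Fin 3) → stdSimplex ℝ (Fin 3) → ℤ),
      coboundary ψ = 0 → (∀ x y z i, x i = 0 → y i = 0 → z i = 0 → ψ x y z = 0) →
      ∀ p x y i, x i = 0 → y i = 0 → sd₁ (ψ p) x y = ψ p x y := by
    intro ψ hψ h p x y i hx hy
    -- The cocycle identity on p, the midpoint, x and y: its term without p lies on a side and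
    -- vanishes.
    have := congrFun₂ (congrFun₂ hψ p (center ![x, y])) x y
    simp only [coboundary, Pi.zero_apply] at this
    rw [h _ _ _ i (hc x y i hx hy) hx hy] at this
    rw [sd₁]
    linarith
  induction m generalizing ψ with
  | zero => rfl
  | succ m ih =>
    rw [Function.iterate_succ_apply, ih]
    · rw [sd₂, step ψ hψ h _ _ _ 0 (by simp) (by simp),
        step ψ hψ h _ _ _ 1 (by simp) (by simp),
        step ψ hψ h _ _ _ 2 (by simp) (by simp)]
      have := congrFun₂ (congrFun₂ hψ (center ![vertex 0, vertex 1, vertex 2]) (vertex 0))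
        (vertex 1) (vertex 2)
      simp only [coboundary, Pi.zero_apply] at this
      linarith
    · rw [coboundary_sd₂, hψ]
      ext x y z w
      simp [sd₃, sd₂, sd₁]
    · intro x y z i hx hy hz
      rw [sd₂, step ψ hψ h _ _ _ i hy hz, step ψ hψ h _ _ _ i hx hz, step ψ hψ h _ _ _ i hx hy,
        h _ _ _ i (hc3 _ _ _ i hx hy hz) hy hz, h _ _ _ i (hc3 _ _ _ i hx hy hz) hx hz,
        h _ _ _ i (hc3 _ _ _ i hx hy hz) hx hy]
      rfl

end SubdividedCochain

/-! ### Singular chains and bounding chains. -/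

section Homology

open Simplicial SSet

/-- The `i`-th face of a singular simplex. -/
noncomputable def ContinuousMap.singularFace {X : Type*} [TopologicalSpace X] {n : ℕ}
    (σ : C(stdSimplex ℝ (Fin (n + 2)), X)) (i : Fin (n + 2)) : C(stdSimplex ℝ (Fin (n + 1)), X) :=
  σ.comp ⟨stdSimplex.map i.succAbove, stdSimplex.continuous_map _⟩

namespace SSet

variable (S : SSet.{u})

/-- A family of elements that detects the equality of homomorphisms spans a module. -/
theorem _root_.ModuleCat.span_eq_top_of_hom_ext {k : Type*} [Ring k] {N : ModuleCat.{u} k}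
    {s : Set N} (h : ∀ {T : ModuleCat.{u} k} (f g : N ⟶ T), (∀ x ∈ s, f x = g x) → f = g) :
    Submodule.span k s = ⊤ := by
  have h' : ModuleCat.ofHom (Submodule.span k s).mkQ = ModuleCat.ofHom 0 :=
    h _ _ fun x hx => by simpa using Submodule.subset_span hx
  have h'' : (Submodule.span k s).mkQ = 0 := congrArg ModuleCat.Hom.hom h'
  rw [← Submodule.ker_mkQ (Submodule.span k s), h'', LinearMap.ker_zero]

/-- The integral chain of a simplicial set given by a single simplex. -/
noncomputable def simplexChain {n : ℕ} (x : S _⦋n⦌) :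
    (S.chainComplex (ModuleCat.of ℤ (ULift.{u} ℤ))).X n :=
  S.ιChainComplex (R := ModuleCat.of ℤ (ULift.{u} ℤ)) x (ULift.up (1 : ℤ))

theorem d_simplexChain {n : ℕ} (x : S _⦋n + 1⦌) :
    (S.chainComplex (ModuleCat.of ℤ (ULift.{u} ℤ))).d (n + 1) n (S.simplexChain x) =
      ∑ i : Fin (n + 2), (-1 : ℤ) ^ (i : ℕ) • S.simplexChain (S.δ i x) := by
  rw [simplexChain, ← ModuleCat.comp_apply, S.ιChainComplex_d]
  refine (LinearMap.congr_fun (ModuleCat.hom_sum _ _) _).trans ?_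
  rw [LinearMap.sum_apply]
  rfl

theorem hom_ext_simplexChain {n : ℕ} {T : ModuleCat.{u} ℤ}
    {f g : (S.chainComplex (ModuleCat.of ℤ (ULift.{u} ℤ))).X n ⟶ T}
    (h : ∀ x : S _⦋n⦌, f (S.simplexChain x) = g (S.simplexChain x)) : f = g := by
  refine SSet.chainComplex_hom_ext fun x => ?_
  ext ⟨a⟩
  have ha : (ULift.up a : ULift.{u} ℤ) = a • ULift.up (1 : ℤ) := by
    ext; simp
  have := congrArg (a • ·) (h x)
  simp only [simplexChain, ← map_zsmul] at this
  rw [ha]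
  exact this

theorem span_simplexChain (n : ℕ) :
    Submodule.span ℤ (Set.range (S.simplexChain (n := n))) = ⊤ :=
  ModuleCat.span_eq_top_of_hom_ext fun _ _ h => S.hom_ext_simplexChain fun x => h _ ⟨x, rfl⟩

/-- The linear form on chains with given values on simplices. -/
noncomputable def chainEval {n : ℕ} (f : S _⦋n⦌ → ℤ) :
    (S.chainComplex (ModuleCat.of ℤ (ULift.{u} ℤ))).X n ⟶ ModuleCat.of ℤ (ULift.{u} ℤ) :=
  Sigma.desc fun x => f x • 𝟙 _

theorem chainEval_simplexChain {n : ℕ} (f : S _⦋n⦌ → ℤ) (x : S _⦋n⦌) :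
    S.chainEval f (S.simplexChain x) = ULift.up (f x) := by
  have h : S.ιChainComplex (R := ModuleCat.of ℤ (ULift.{u} ℤ)) x ≫ S.chainEval f = f x • 𝟙 _ :=
    Sigma.ι_desc _ _
  have := congrArg (fun g => g (ULift.up (1 : ℤ))) (congrArg ModuleCat.Hom.hom h)
  refine Eq.trans this ?_
  ext
  simp

end SSet

/-- If the second homology of a space vanishes, then every singular `2`-cycle is the boundary of a
singular `3`-chain. -/
theorem exists_bounding_chain {X : Type u} [TopologicalSpace X] (hX : IsZero (integralHomology 2 X))
    {J : Type*} [Fintype J] (σ : J → C(stdSimplex ℝ (Fin 3), X)) (a : J → ℤ)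
    (hσ : ∀ {A : Type u} [AddCommGroup A] (f : C(stdSimplex ℝ (Fin 2), X) → A),
      ∑ j, a j • ∑ i : Fin 3, (-1 : ℤ) ^ (i : ℕ) • f ((σ j).singularFace i) = 0) :
    ∃ (s : Finset C(stdSimplex ℝ (Fin 4), X)) (w : C(stdSimplex ℝ (Fin 4), X) → ℤ),
      ∀ f : C(stdSimplex ℝ (Fin 3), X) → ℤ, ∑ j, a j * f (σ j) =
        ∑ τ ∈ s, w τ * ∑ i : Fin 4, (-1 : ℤ) ^ (i : ℕ) * f (τ.singularFace i) := by
  classical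
  let S := TopCat.toSSet.obj (TopCat.of X)
  let R := ModuleCat.of ℤ (ULift.{u} ℤ)
  let e (n : ℕ) : S _⦋n⦌ ≃ C(stdSimplex ℝ (Fin (n + 1)), X) :=
    (TopCat.of X).toSSetObjEquiv (Opposite.op ⦋n⦌)
  have he : ∀ (n : ℕ) (x : S _⦋n + 1⦌) (i : Fin (n + 2)),
      e n (S.δ i x) = (e (n + 1) x).singularFace i := fun n x i => by
    ext z
    exact TopCat.toSSetObjEquiv_δ_apply ..
  have he' : ∀ (n : ℕ) (x : C(stdSimplex ℝ (Fin (n + 2)), X)) (i : Fin (n + 2)),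
      S.δ i ((e (n + 1)).symm x) = (e n).symm (x.singularFace i) := fun n x i => by
    rw [Equiv.eq_symm_apply, he, Equiv.apply_symm_apply]
  let K := S.chainComplex R
  -- Singular homology unfolds to the homology of the chain complex of the singular simplicial set.
  have hK : IsZero (K.homology 2) := hX
  rw [← HomologicalComplex.exactAt_iff_isZero_homology,
    HomologicalComplex.exactAt_iff' K 3 2 1 (by simp) (by simp),
    ShortComplex.moduleCat_exact_iff] at hK
  have hz : K.d 2 1 (∑ j, a j • S.simplexChain ((e 2).symm (σ j))) = 0 := by
    -- The cycle condition, assumed for all functions to abelian groups, is used for the universal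
    -- one, which sends an edge to its generator in the chain group.
    rw [map_sum, ← hσ (A := K.X 1) fun x => S.simplexChain ((e 1).symm x)]
    refine Finset.sum_congr rfl fun j _ => ?_
    rw [map_zsmul, S.d_simplexChain]
    simp only [he']
  obtain ⟨y, hy⟩ : ∃ y : K.X 3, K.d 3 2 y = _ := hK _ hz
  have hyt : y ∈ Submodule.span ℤ (Set.range (S.simplexChain (n := 3))) := by
    rw [S.span_simplexChain]; trivial
  rw [Finsupp.mem_span_range_iff_exists_finsupp] at hyt
  obtain ⟨c, rfl⟩ := hyt
  refine ⟨c.support.image (e 3), fun τ => c ((e 3).symm τ), fun f => ?_⟩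
  let F : K.X 2 →+ ℤ := AddEquiv.ulift.toAddMonoidHom.comp
    (S.chainEval fun x => f (e 2 x)).hom.toAddMonoidHom
  have hF : ∀ x, F (S.simplexChain x) = f (e 2 x) := fun x =>
    congrArg ULift.down (S.chainEval_simplexChain _ x)
  have h := congrArg F hy
  rw [Finsupp.sum, map_sum, map_sum, map_sum] at h
  rw [Finset.sum_image fun _ _ _ _ h => (e 3).injective h]
  refine Eq.trans (Finset.sum_congr rfl fun j _ => ?_)
    (h.symm.trans (Finset.sum_congr rfl fun x _ => ?_))
  · rw [map_zsmul, hF, Equiv.apply_symm_apply, smul_eq_mul]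
  · refine (congrArg (fun v => F (K.d 3 2 v)) (int_smul_eq_zsmul _ _ _)).trans ?_
    rw [map_zsmul, map_zsmul, S.d_simplexChain, map_sum]
    simp only [Equiv.symm_apply_apply, map_zsmul, hF, he, smul_eq_mul]

end Homology

/-! ### Pushing a manifold into its interior. -/

section PushInterior

open Set Topology

variable {n : ℕ} [NeZero n] {M : Type*} [TopologicalSpace M] [ChartedSpace (EuclideanHalfSpace n) M]
  [IsManifold (𝓡∂ n) ∞ M]

theorem isInteriorPoint_iff_extChartAt_pos {x y : M} (hx : x ∈ (extChartAt (𝓡∂ n) y).source) :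
    (𝓡∂ n).IsInteriorPoint x ↔ 0 < extChartAt (𝓡∂ n) y x 0 := by
  rw [ModelWithCorners.isInteriorPoint_iff_of_mem_atlas (n := ∞) (by simp)
    (chart_mem_atlas _ y) (by simpa using hx)]
  change extChartAt (𝓡∂ n) y x ∈ interior (extChartAt (𝓡∂ n) y).target ↔ _
  constructor
  · intro h
    have h' := interior_mono (extChartAt_target_subset_range y) h
    rwa [interior_range_modelWithCornersEuclideanHalfSpace] at h'
  · intro h
    have h1 := extChartAt_target_mem_nhdsWithin' (I := 𝓡∂ n) hx
    have h2 : range (𝓡∂ n) ∈ 𝓝 (extChartAt (𝓡∂ n) y x) := by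
      rw [← mem_interior_iff_mem_nhds, interior_range_modelWithCornersEuclideanHalfSpace]
      exact h
    rw [mem_interior_iff_mem_nhds]
    rwa [nhdsWithin_eq_nhds.2 h2] at h1

/-- Near every point, a manifold with boundary can be pushed into its interior. -/
theorem exists_push_interior_nhds [T2Space M] (y : M) {W : Set M} (hW : W ∈ 𝓝 y) :
    ∃ p : C(M, M), (∀ x ∉ W, p x = x) ∧ (∀ x, p x = x ∨ p x ∈ (𝓡∂ n).interior M) ∧
      ∀ᶠ x in 𝓝 y, p x ∈ (𝓡∂ n).interior M := by
  classical
  set φ := extChartAt (𝓡∂ n) y with hφ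
  set v₀ := φ y with hv₀
  have hT : φ.target ∩ φ.symm ⁻¹' W ∈ 𝓝[range (𝓡∂ n)] v₀ :=
    Filter.inter_mem (extChartAt_target_mem_nhdsWithin y)
      (mem_nhdsWithin_of_mem_nhds ((continuousAt_extChartAt_symm y).preimage_mem_nhds
        (by rwa [extChartAt_to_inv])))
  obtain ⟨R, hR, hRT⟩ := (nhdsWithin_hasBasis Metric.nhds_basis_closedBall _).mem_iff.1 hT
  let e₀ : EuclideanSpace ℝ (Fin n) := EuclideanSpace.single 0 1
  -- A point is moved inwards along the coordinate 0 by its distance to the complement scale of the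
  -- ball, R minus the distance to the center. By the triangle inequality the ball is mapped into
  -- itself.
  let g : EuclideanSpace ℝ (Fin n) → ℝ := fun v => max 0 (R - dist v v₀)
  let q : EuclideanSpace ℝ (Fin n) → EuclideanSpace ℝ (Fin n) := fun v => v + g v • e₀
  have hg : ∀ v, 0 ≤ g v := fun v => le_max_left _ _
  have hg0 : ∀ v, v ∉ Metric.closedBall v₀ R → g v = 0 := fun v hv => by
    rw [Metric.mem_closedBall, not_le] at hv
    exact max_eq_left (by linarith)
  have hq0 : ∀ v, q v 0 = v 0 + g v := fun v => by simp [q, e₀]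
  have hq : Continuous q := by fun_prop
  have hqB : ∀ v ∈ Metric.closedBall v₀ R, q v ∈ Metric.closedBall v₀ R := fun v hv => by
    rw [Metric.mem_closedBall] at hv ⊢
    have h1 : dist (q v) v = g v := by
      simp [q, dist_eq_norm, norm_smul, e₀, abs_of_nonneg (hg v)]
    have h2 : g v = R - dist v v₀ := max_eq_right (by linarith)
    linarith [dist_triangle (q v) v v₀]
  have hqid : ∀ v, v ∉ Metric.closedBall v₀ R → q v = v := fun v hv => by simp [q, hg0 v hv]
  have hqr : ∀ v ∈ range (𝓡∂ n), q v ∈ range (𝓡∂ n) := fun v hv => by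
    rw [range_modelWithCornersEuclideanHalfSpace] at hv ⊢
    have := hg v
    have hv' : 0 ≤ v 0 := hv
    change 0 ≤ q v 0
    rw [hq0]; linarith
  have hqT : ∀ v ∈ φ.target, q v ∈ φ.target := fun v hv => by
    by_cases h : v ∈ Metric.closedBall v₀ R
    · exact (hRT ⟨hqB v h, hqr v (extChartAt_target_subset_range y hv)⟩).1
    · rwa [hqid v h]
  set K := φ.symm '' (Metric.closedBall v₀ R ∩ range (𝓡∂ n)) with hK
  -- Compactness makes K closed in all of M and not only in the chart domain, so the chart formula
  -- glues continuously with the identity.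
  have hKc : IsClosed K :=
    (((isCompact_closedBall v₀ R).inter_right (𝓡∂ n).isClosed_range).image_of_continuousOn
      ((continuousOn_extChartAt_symm y).mono fun v hv => (hRT hv).1)).isClosed
  have hKS : K ⊆ φ.source := by
    rintro _ ⟨v, hv, rfl⟩
    exact φ.map_target (hRT hv).1
  let p : M → M := fun x => if x ∈ φ.source then φ.symm (q (φ x)) else x
  have hpS : ∀ x ∈ φ.source, p x = φ.symm (q (φ x)) := fun x hx => if_pos hx
  have hpid : ∀ x, φ x ∉ Metric.closedBall v₀ R → p x = x := fun x hx => by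
    by_cases h : x ∈ φ.source
    · rw [hpS x h, hqid _ hx, φ.left_inv h]
    · exact if_neg h
  have hpK : ∀ x ∉ K, p x = x := fun x hx => by
    by_cases h : x ∈ φ.source
    · refine hpid x fun hB => hx ⟨φ x, ⟨hB, ?_⟩, φ.left_inv h⟩
      exact extChartAt_target_subset_range y (φ.map_source h)
    · exact if_neg h
  have hpc : Continuous p := by
    rw [continuous_iff_continuousAt]
    intro x
    by_cases hx : x ∈ φ.source
    · have hS : φ.source ∈ 𝓝 x := (isOpen_extChartAt_source y).mem_nhds hx
      have : ContinuousOn (fun x => φ.symm (q (φ x))) φ.source :=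
        (continuousOn_extChartAt_symm y).comp
          (hq.comp_continuousOn (continuousOn_extChartAt y)) fun x hx => hqT _ (φ.map_source hx)
      exact (this.continuousAt hS).congr (Filter.eventually_of_mem hS fun x hx => (hpS x hx).symm)
    · have hS : Kᶜ ∈ 𝓝 x := hKc.isOpen_compl.mem_nhds fun h => hx (hKS h)
      exact continuousAt_id.congr (Filter.eventually_of_mem hS fun x hx => (hpK x hx).symm)
  have hpi : ∀ x ∈ φ.source, 0 < g (φ x) → p x ∈ (𝓡∂ n).interior M := fun x hx h => by
    have hT := hqT _ (φ.map_source hx)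
    rw [hpS x hx]
    change (𝓡∂ n).IsInteriorPoint _
    rw [isInteriorPoint_iff_extChartAt_pos (φ.map_target hT), φ.right_inv hT, hq0]
    have h0 : φ x ∈ range (𝓡∂ n) := extChartAt_target_subset_range y (φ.map_source hx)
    rw [range_modelWithCornersEuclideanHalfSpace] at h0
    have h0' : 0 ≤ φ x 0 := h0
    linarith
  refine ⟨⟨p, hpc⟩, fun x hx => ?_, fun x => ?_, ?_⟩
  · refine hpK x ?_
    rintro ⟨v, hv, rfl⟩
    exact hx (hRT hv).2
  · by_cases hx : x ∈ φ.source
    · rcases (hg (φ x)).eq_or_lt with h | h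
      · left
        change p x = x
        rw [hpS x hx]
        simp only [q, ← h, zero_smul, add_zero]
        exact φ.left_inv hx
      · exact Or.inr (hpi x hx h)
    · exact Or.inl (if_neg hx)
  · have h1 : ∀ᶠ x in 𝓝 y, x ∈ φ.source := extChartAt_source_mem_nhds y
    have h2 : ∀ᶠ x in 𝓝 y, φ x ∈ Metric.ball v₀ R :=
      (continuousAt_extChartAt y).eventually (Metric.ball_mem_nhds _ hR)
    filter_upwards [h1, h2] with x hx hx'
    refine hpi x hx (lt_max_of_lt_right ?_)
    rw [Metric.mem_ball] at hx'
    linarith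

/-- A compact manifold with boundary can be mapped to its interior by a map that is the identity on
a given closed subset of the interior. -/
theorem exists_continuousMap_interior [T2Space M] [CompactSpace M] {K : Set M} (hK : IsClosed K)
    (hKi : K ⊆ (𝓡∂ n).interior M) :
    ∃ h : C(M, M), (∀ x ∈ K, h x = x) ∧ ∀ x, h x ∈ (𝓡∂ n).interior M := by
  have hb : IsCompact ((𝓡∂ n).boundary M) :=
    (ModelWithCorners.isClosed_boundary (n := ∞) (by simp)).isCompact
  -- Local pushes are composed by compactness of the boundary. The middle clause, that each point is
  -- fixed or lands in the interior, guarantees that a later push does not undo an earlier one.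
  obtain ⟨h, h1, h2, h3⟩ := hb.induction_on (p := fun s => ∃ h : C(M, M), (∀ x ∈ K, h x = x) ∧
      (∀ x, h x = x ∨ h x ∈ (𝓡∂ n).interior M) ∧ ∀ x ∈ s, h x ∈ (𝓡∂ n).interior M)
    ⟨ContinuousMap.id M, fun _ _ => rfl, fun _ => Or.inl rfl, fun _ h => h.elim⟩
    (fun s t hst ⟨h, h1, h2, h3⟩ => ⟨h, h1, h2, fun x hx => h3 x (hst hx)⟩)
    (by
      rintro s t ⟨h, h1, h2, h3⟩ ⟨h', h1', h2', h3'⟩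
      refine ⟨h'.comp h, fun x hx => ?_, fun x => ?_, fun x hx => ?_⟩
      · simp [h1 x hx, h1' x hx]
      · rcases h2' (h x) with e | e
        · simp only [ContinuousMap.comp_apply, e]
          exact h2 x
        · exact Or.inr e
      · simp only [ContinuousMap.comp_apply]
        rcases h2 x with e | e
        · rcases hx with hx | hx
          · rcases h2' (h x) with e' | e'
            · rw [e']; exact h3 x hx
            · exact e'
          · rw [e]; exact h3' x hx
        · rcases h2' (h x) with e' | e'
          · rwa [e']
          · exact e')
    (by
      intro y hy
      have hyK : y ∉ K := fun h => by
        rw [← ModelWithCorners.compl_interior] at hy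
        exact hy (hKi h)
      obtain ⟨p, h1, h2, h3⟩ := exists_push_interior_nhds (n := n) y
        (hK.isOpen_compl.mem_nhds hyK)
      exact ⟨_, mem_nhdsWithin_of_mem_nhds h3, p, fun x hx => h1 x (fun h => h hx), h2,
        fun x hx => hx⟩)
  refine ⟨h, h1, fun x => ?_⟩
  by_cases hx : x ∈ (𝓡∂ n).interior M
  · rcases h2 x with e | e
    · rwa [e]
    · exact e
  · exact h3 x (by rwa [← ModelWithCorners.compl_interior])

end PushInterior

/-! ### Labellings and the count of small triangles. -/

section Labels

open SubdividedCochain stdSimplex Topology Filter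

/-- The signed indicator of the triangle `0, 1, 2` on triples of labels. -/
def labelSign (i j k : Fin 4) : ℤ :=
  if (i = 0 ∧ j = 1 ∧ k = 2) ∨ (i = 1 ∧ j = 2 ∧ k = 0) ∨ (i = 2 ∧ j = 0 ∧ k = 1) then 1
  else if (i = 1 ∧ j = 0 ∧ k = 2) ∨ (i = 0 ∧ j = 2 ∧ k = 1) ∨ (i = 2 ∧ j = 1 ∧ k = 0) then -1
  else 0

/-- `labelSign` is the cochain on the boundary of the tetrahedron 0123 dual to the face 012. With
one label missing, the four labels lie in a single face, so there is no obstruction to the cocycle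
identity. -/
theorem coboundary_labelSign : ∀ a i j k l : Fin 4, i ≠ a → j ≠ a → k ≠ a → l ≠ a →
    coboundary labelSign i j k l = 0 := by
  decide

theorem labelSign_eq_zero : ∀ a i j k : Fin 4, a ≠ 3 → i ≠ a → j ≠ a → k ≠ a →
    labelSign i j k = 0 := by
  decide

/-- If near every point of a compact metric space some label is missing, then some label is missing
in every ball of a certain radius. -/
theorem exists_radius_missing_label {P : Type*} [PseudoMetricSpace P] [CompactSpace P]
    {L : P → Fin 4} {S : Set (Fin 4)} (hL : ∀ x, ∃ a ∈ S, ∀ᶠ y in 𝓝 x, L y ≠ a) :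
    ∃ r > 0, ∀ x, ∃ a ∈ S, ∀ y, dist x y ≤ r → L y ≠ a := by
  choose a ha h using hL
  obtain ⟨δ, hδ, H⟩ := lebesgue_number_lemma_of_metric (s := Set.univ) isCompact_univ
    (c := fun x => interior {y | L y ≠ a x}) (fun _ => isOpen_interior)
    fun x _ => Set.mem_iUnion.2 ⟨x, mem_interior_iff_mem_nhds.2 (h x)⟩
  -- Halving the Lebesgue number puts the closed ball inside the open one.
  refine ⟨δ / 2, half_pos hδ, fun x => ?_⟩
  obtain ⟨y, hy⟩ := H x trivial
  refine ⟨a y, ha y, fun z hz => interior_subset (hy ?_)⟩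
  rw [Metric.mem_ball, dist_comm]
  linarith

variable {X : Type*} [TopologicalSpace X] (ℓ : X → Fin 4)

/-- The signed number of triangles with labels `0, 1, 2` in the `m`-th barycentric subdivision of a
labelled singular triangle. -/
noncomputable def labelCount (m : ℕ) (σ : C(stdSimplex ℝ (Fin 3), X)) : ℤ :=
  sd₂^[m] (fun x y z => labelSign (ℓ (σ x)) (ℓ (σ y)) (ℓ (σ z))) (vertex 0) (vertex 1) (vertex 2)

theorem labelCount_singularFace (m : ℕ) (τ : C(stdSimplex ℝ (Fin 4), X)) (i : Fin 4) :
    labelCount ℓ m (τ.singularFace i) =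
      sd₂^[m] (fun x y z => labelSign (ℓ (τ x)) (ℓ (τ y)) (ℓ (τ z)))
        (vertex (i.succAbove 0)) (vertex (i.succAbove 1)) (vertex (i.succAbove 2)) := by
  have := congrFun₂ (congrFun (iterate_sd₂_map i.succAbove
    (fun x y z => labelSign (ℓ (τ x)) (ℓ (τ y)) (ℓ (τ z))) m) (vertex 0)) (vertex 1) (vertex 2)
  simp only [map_vertex] at this
  exact this

/-- Subdivision commutes with the coboundary, and the coboundary of the label cochain vanishes on
tetrahedra so small that a label is missing on them. -/
theorem eventually_labelCount_boundary {τ : C(stdSimplex ℝ (Fin 4), X)}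
    (hℓ : ∀ x, ∃ a, ∀ᶠ y in 𝓝 x, ℓ (τ y) ≠ a) :
    ∃ m₀, ∀ m ≥ m₀,
      ∑ i : Fin 4, (-1 : ℤ) ^ (i : ℕ) * labelCount ℓ m (τ.singularFace i) = 0 := by
  set ψ := fun x y z => labelSign (ℓ (τ x)) (ℓ (τ y)) (ℓ (τ z)) with hψ
  obtain ⟨r, hr, H⟩ := exists_radius_missing_label (L := fun x => ℓ (τ x)) (S := Set.univ)
    (by simpa using hℓ)
  have hs : Small₃ r (coboundary ψ) := by
    intro x y z w h1 h2 h3 _ _ _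
    obtain ⟨a, -, ha⟩ := H x
    exact coboundary_labelSign a _ _ _ _ (ha x (by simpa using hr.le)) (ha y h1) (ha z h2) (ha w h3)
  obtain ⟨m₀, h⟩ := eventually_iterate_sd₃_eq_zero hr hs (vertex 0) (vertex 1) (vertex 2) (vertex 3)
  refine ⟨m₀, fun m hm => ?_⟩
  rw [← h m hm, ← coboundary_iterate_sd₂]
  simp only [labelCount_singularFace, Fin.sum_univ_four, coboundary, ← hψ]
  simp [Fin.succAbove, Fin.lt_def]
  ring

theorem eventually_labelCount_eq_zero {σ : C(stdSimplex ℝ (Fin 3), X)}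
    (hℓ : ∀ x, ∃ a ≠ 3, ∀ᶠ y in 𝓝 x, ℓ (σ y) ≠ a) : ∃ m₀, ∀ m ≥ m₀, labelCount ℓ m σ = 0 := by
  obtain ⟨r, hr, H⟩ := exists_radius_missing_label (L := fun x => ℓ (σ x)) (S := {a | a ≠ 3})
    (by simpa using hℓ)
  refine eventually_iterate_sd₂_eq_zero hr ?_ _ _ _
  intro x y z h1 h2 _
  obtain ⟨a, h3, ha⟩ := H x
  exact labelSign_eq_zero a _ _ _ h3 (ha x (by simpa using hr.le)) (ha y h1) (ha z h2)

/-- Without the label 3 the label cochain is a genuine cocycle, and it vanishes on each side of the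
triangle; hence subdividing does not change its value. -/
theorem labelCount_eq {σ : C(stdSimplex ℝ (Fin 3), X)} (h3 : ∀ x, ℓ (σ x) ≠ 3)
    (h : ∀ i, ∃ a ≠ 3, ∀ x : stdSimplex ℝ (Fin 3), x i = 0 → ℓ (σ x) ≠ a) (m : ℕ) :
    labelCount ℓ m σ =
      labelSign (ℓ (σ (vertex 0))) (ℓ (σ (vertex 1))) (ℓ (σ (vertex 2))) := by
  refine iterate_sd₂_eq (ψ := fun x y z => labelSign (ℓ (σ x)) (ℓ (σ y)) (ℓ (σ z))) ?_ ?_ m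
  · ext x y z w
    exact coboundary_labelSign 3 _ _ _ _ (h3 _) (h3 _) (h3 _) (h3 _)
  · intro x y z i hx hy hz
    obtain ⟨a, ha, H⟩ := h i
    exact labelSign_eq_zero a _ _ _ ha (H x hx) (H y hy) (H z hz)

/-- In a space with vanishing second homology that is labelled such that near every point some label
is missing, the number of the triangles with labels `0, 1, 2` in fine subdivisions of a `2`-cycle
vanishes. -/
theorem eventually_sum_labelCount_eq_zero {X : Type u} [TopologicalSpace X]
    (hX : IsZero (integralHomology 2 X)) {ℓ : X → Fin 4} (hℓ : ∀ x, ∃ a, ∀ᶠ y in 𝓝 x, ℓ y ≠ a)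
    {J : Type*} [Fintype J] (σ : J → C(stdSimplex ℝ (Fin 3), X)) (a : J → ℤ)
    (hσ : ∀ {A : Type u} [AddCommGroup A] (f : C(stdSimplex ℝ (Fin 2), X) → A),
      ∑ j, a j • ∑ i : Fin 3, (-1 : ℤ) ^ (i : ℕ) • f ((σ j).singularFace i) = 0) :
    ∃ m₀, ∀ m ≥ m₀, ∑ j, a j * labelCount ℓ m (σ j) = 0 := by
  obtain ⟨s, w, h⟩ := exists_bounding_chain hX σ a hσ
  have hτ : ∀ τ : C(stdSimplex ℝ (Fin 4), X), ∃ m₀, ∀ m ≥ m₀,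
      ∑ i : Fin 4, (-1 : ℤ) ^ (i : ℕ) * labelCount ℓ m (τ.singularFace i) = 0 := fun τ =>
    eventually_labelCount_boundary ℓ fun x =>
      (hℓ (τ x)).imp fun a ha => τ.continuous.continuousAt.eventually ha
  choose m₀ hm₀ using hτ
  refine ⟨s.sup m₀, fun m hm => ?_⟩
  rw [h]
  exact Finset.sum_eq_zero fun τ hτ => by rw [hm₀ τ m ((Finset.le_sup hτ).trans hm), mul_zero]

end Labels

/-! ### Ordered barycentric coordinates. -/

section OrderStatistics

/-- The `k`-th value in the decreasing rearrangement of `x`. -/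
noncomputable def orderStat (k : Fin 4) (x : Fin 4 → ℝ) : ℝ :=
  Finset.univ.sup' ⟨1, Finset.mem_univ _⟩ fun σ : Equiv.Perm (Fin 4) =>
    (Finset.Iic k).inf' ⟨k, Finset.mem_Iic.2 le_rfl⟩ fun i => x (σ i)

theorem continuous_orderStat (k : Fin 4) : Continuous (orderStat k) := by
  unfold orderStat
  exact Continuous.finset_sup'_apply _ fun σ _ =>
    Continuous.finset_inf'_apply _ fun i _ => continuous_apply _

theorem orderStat_comp_perm (k : Fin 4) (x : Fin 4 → ℝ) (π : Equiv.Perm (Fin 4)) :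
    orderStat k (x ∘ π) = orderStat k x := by
  have h : ∀ (x : Fin 4 → ℝ) (π : Equiv.Perm (Fin 4)), orderStat k (x ∘ π) ≤ orderStat k x :=
    fun x π => Finset.sup'_le _ _ fun σ _ =>
      Finset.le_sup' (fun σ : Equiv.Perm (Fin 4) =>
        (Finset.Iic k).inf' ⟨k, Finset.mem_Iic.2 le_rfl⟩ fun i => x (σ i)) (Finset.mem_univ (π * σ))
  refine le_antisymm (h x π) ?_
  have := h (x ∘ π) π⁻¹
  rwa [Function.comp_assoc, ← Equiv.Perm.coe_mul, mul_inv_cancel, Equiv.Perm.coe_one,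
    Function.comp_id] at this

theorem orderStat_of_antitone (k : Fin 4) {x : Fin 4 → ℝ} {σ : Equiv.Perm (Fin 4)}
    (h : Antitone (x ∘ σ)) : orderStat k x = x (σ k) := by
  -- Pigeonhole: the k + 1 indices up to k cannot all be mapped below k.
  have hp : ∀ (π : Equiv.Perm (Fin 4)) (k : Fin 4), ∃ i ≤ k, k ≤ π i := by decide
  refine le_antisymm (Finset.sup'_le _ _ fun τ _ => ?_) ?_
  · obtain ⟨i, hi, hk⟩ := hp (σ⁻¹ * τ) k
    refine (Finset.inf'_le _ (Finset.mem_Iic.2 hi)).trans ?_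
    simpa using h hk
  · refine le_trans ?_ (Finset.le_sup' (fun σ : Equiv.Perm (Fin 4) =>
        (Finset.Iic k).inf' ⟨k, Finset.mem_Iic.2 le_rfl⟩ fun i => x (σ i)) (Finset.mem_univ σ))
    exact Finset.le_inf' _ _ fun i hi => h (Finset.mem_Iic.1 hi)

theorem exists_perm_antitone (x : Fin 4 → ℝ) : ∃ σ : Equiv.Perm (Fin 4), Antitone (x ∘ σ) :=
  ⟨Fin.revPerm.trans (Tuple.sort x), fun _ _ h => Tuple.monotone_sort x (Fin.rev_le_rev.2 h)⟩

/-- The coordinates `d` and `c` are positive, the smallest and the second smallest. -/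
def WeakFlag (c d : Fin 4) (x : Fin 4 → ℝ) : Prop :=
  0 < x d ∧ x d ≤ x c ∧ ∀ j, j ≠ c → j ≠ d → x c ≤ x j

/-- The coordinates `d` and `c` are positive, strictly the smallest and the second smallest. -/
def StrictFlag (c d : Fin 4) (x : Fin 4 → ℝ) : Prop :=
  0 < x d ∧ x d < x c ∧ ∀ j, j ≠ c → j ≠ d → x c < x j

theorem StrictFlag.weakFlag {c d : Fin 4} {x : Fin 4 → ℝ} (h : StrictFlag c d x) :
    WeakFlag c d x :=
  ⟨h.1, h.2.1.le, fun j hc hd => (h.2.2 j hc hd).le⟩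

theorem WeakFlag.le {c d : Fin 4} {x : Fin 4 → ℝ} (h : WeakFlag c d x) (j : Fin 4) :
    x d ≤ x j := by
  by_cases hc : j = c
  · rw [hc]; exact h.2.1
  · by_cases hd : j = d
    · rw [hd]
    · exact h.2.1.trans (h.2.2 j hc hd)

theorem WeakFlag.pos {c d : Fin 4} {x : Fin 4 → ℝ} (h : WeakFlag c d x) (j : Fin 4) : 0 < x j :=
  h.1.trans_le (h.le j)

theorem StrictFlag.eq_of_weakFlag {c d c' d' : Fin 4} {x : Fin 4 → ℝ} (h : StrictFlag c d x)
    (h' : WeakFlag c' d' x) (hcd : c' ≠ d') : c = c' ∧ d = d' := by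
  have hd : d = d' := by
    by_contra hd
    have h1 := h'.le d
    by_cases hc : d' = c
    · rw [hc] at h1; linarith [h.2.1]
    · linarith [h.2.1, h.2.2 d' hc (Ne.symm hd)]
  subst hd
  refine ⟨?_, rfl⟩
  by_contra hc
  have hcd' : c ≠ d := fun e => by have := h.2.1; rw [e] at this; exact lt_irrefl _ this
  linarith [h.2.2 c' (Ne.symm hc) hcd, h'.2.2 c hc hcd']

theorem isOpen_strictFlag (c d : Fin 4) : IsOpen {x | StrictFlag c d x} := by
  simp only [StrictFlag, Set.ofPred_and, Set.ofPred_forall]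
  refine (isOpen_lt (by fun_prop) (by fun_prop)).inter
    ((isOpen_lt (by fun_prop) (by fun_prop)).inter ?_)
  exact isOpen_iInter_of_finite fun j => isOpen_iInter_of_finite fun _ =>
    isOpen_iInter_of_finite fun _ => isOpen_lt (by fun_prop) (by fun_prop)

end OrderStatistics

/-! ### A labelling of the polyhedron around an arc parallel to an edge. -/

namespace FaceGluing

open Topology Filter

variable {ι : Type v} (T : FaceGluing ι)

/-- The point of the polyhedron with given barycentric coordinates in a tetrahedron. -/
def point (t : ι) (x : stdSimplex ℝ (Fin 4)) : T.Realization := Quot.mk T.GlueRel ⟨t, x⟩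

theorem exists_eq_point (p : T.Realization) : ∃ t x, p = T.point t x := by
  obtain ⟨⟨t, x⟩, rfl⟩ := Quot.exists_rep p
  exact ⟨t, x, rfl⟩

theorem continuous_point (t : ι) : Continuous (T.point t) :=
  continuous_quot_mk.comp continuous_sigmaMk

/-- The `k`-th greatest barycentric coordinate of a point. -/
noncomputable def coordStat (k : Fin 4) : T.Realization → ℝ :=
  Quot.lift (fun p => orderStat k p.2) fun p q ⟨i, _, _, h⟩ => by
    rw [← orderStat_comp_perm k (q.2 : Fin 4 → ℝ) (T.perm p.1 i)]
    congr 1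
    ext j
    exact (h j).symm

theorem continuous_coordStat (k : Fin 4) : Continuous (T.coordStat k) :=
  continuous_quot_lift _ (continuous_sigma fun _ =>
    (continuous_orderStat k).comp continuous_subtype_val)

theorem coordStat_point (k : Fin 4) (t : ι) {x : stdSimplex ℝ (Fin 4)} {σ : Equiv.Perm (Fin 4)}
    (h : Antitone (x ∘ σ)) : T.coordStat k (T.point t x) = x (σ k) :=
  orderStat_of_antitone k h

/-- Gluing only affects points with a vanishing coordinate, so the function `f` that remembers
exactly the interior points of the tetrahedra descends to the quotient. -/
theorem point_injective_of_pos {t t' : ι} {x x' : stdSimplex ℝ (Fin 4)}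
    (h : T.point t x = T.point t' x') (hx : ∀ i, 0 < x i) :
    (⟨t, x⟩ : Σ _ : ι, stdSimplex ℝ (Fin 4)) = ⟨t', x'⟩ := by
  classical
  let f : (Σ _ : ι, stdSimplex ℝ (Fin 4)) → Option (Σ _ : ι, stdSimplex ℝ (Fin 4)) :=
    fun p => if ∀ i, 0 < p.2 i then some p else none
  have hf : ∀ p q, T.GlueRel p q → f p = f q := by
    rintro p q ⟨i, hi, -, h⟩
    rw [show f p = none from if_neg fun h => (h i).ne' hi,
      show f q = none from if_neg fun h' => (h' (T.perm p.1 i i)).ne' ((h i).trans hi)]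
  have h1 : f ⟨t, x⟩ = f ⟨t', x'⟩ := congrArg (Quot.lift f hf) h
  rw [show f ⟨t, x⟩ = some ⟨t, x⟩ from if_pos hx] at h1
  by_cases h2 : ∀ i, 0 < x' i
  · rw [show f ⟨t', x'⟩ = some ⟨t', x'⟩ from if_pos h2] at h1
    exact Option.some_injective _ h1
  · rw [show f ⟨t', x'⟩ = none from if_neg h2] at h1
    cases h1

theorem mem_vertices_iff (p : T.Realization) : p ∈ T.vertices ↔ T.coordStat 1 p = 0 := by
  have hsum : ∀ (x : stdSimplex ℝ (Fin 4)) (σ : Equiv.Perm (Fin 4)),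
      x (σ 0) + x (σ 1) + x (σ 2) + x (σ 3) = 1 := fun x σ => by
    rw [← Fin.sum_univ_four (fun i => x (σ i)), Equiv.sum_comp σ fun i => x i]
    exact stdSimplex.sum_eq_one x
  constructor
  · rintro ⟨t, x, i, hi, rfl⟩
    obtain ⟨σ, hσ⟩ := exists_perm_antitone x
    change T.coordStat 1 (T.point t x) = 0
    rw [T.coordStat_point 1 t hσ]
    have h1 : x i ≤ x (σ 0) := by simpa using hσ (Fin.zero_le (σ⁻¹ i))
    linarith [hsum x σ, stdSimplex.zero_le x (σ 1), stdSimplex.zero_le x (σ 2),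
      stdSimplex.zero_le x (σ 3)]
  · intro h
    obtain ⟨t, x, rfl⟩ := T.exists_eq_point p
    obtain ⟨σ, hσ⟩ := exists_perm_antitone x
    rw [T.coordStat_point 1 t hσ] at h
    have h2 : x (σ 2) ≤ x (σ 1) := hσ (by decide : (1 : Fin 4) ≤ 2)
    have h3 : x (σ 3) ≤ x (σ 1) := hσ (by decide : (1 : Fin 4) ≤ 3)
    refine ⟨t, x, σ 0, ?_, rfl⟩
    linarith [hsum x σ, stdSimplex.zero_le x (σ 2), stdSimplex.zero_le x (σ 3)]

/-- The set consists of interior points of one tetrahedron, which are not identified with any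
others; its preimage is thus the same open set in that tetrahedron and empty in the rest. -/
theorem isOpen_image_strictFlag (t : ι) (c d : Fin 4) :
    IsOpen (T.point t '' {x | StrictFlag c d x}) := by
  refine (isQuotientMap_quot_mk (r := T.GlueRel)).isOpen_preimage.1 ?_
  rw [isOpen_sigma_iff]
  intro t'
  by_cases ht : t' = t
  · subst ht
    have : Sigma.mk t' ⁻¹' (Quot.mk T.GlueRel ⁻¹' (T.point t' '' {x | StrictFlag c d x})) =
        {x : stdSimplex ℝ (Fin 4) | StrictFlag c d x} := by
      ext x
      constructor
      · rintro ⟨y, hy, h⟩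
        obtain rfl : y = x := by
          simpa using T.point_injective_of_pos h hy.weakFlag.pos
        exact hy
      · intro hx
        exact ⟨x, hx, rfl⟩
    exact (congrArg IsOpen this).mpr ((isOpen_strictFlag c d).preimage continuous_subtype_val)
  · convert isOpen_empty
    rw [Set.eq_empty_iff_forall_notMem]
    rintro x ⟨y, hy, h⟩
    have := congrArg Sigma.fst (T.point_injective_of_pos h hy.weakFlag.pos)
    exact ht this.symm

/-- A labelling of the points of a triangulation: `0` near the edges, `1` near the faces away from
the edges, `2` elsewhere in the part of the tetrahedron `t` where the coordinates `c`, `d` are the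
smallest, and `3` in the rest. -/
noncomputable def label (t : ι) (c d : Fin 4) (p : T.Realization) : Fin 4 :=
  open Classical in
  if 2 * T.coordStat 2 p < T.coordStat 1 p then 0
  else if 2 * T.coordStat 3 p < T.coordStat 2 p then 1
  else if ∃ x, p = T.point t x ∧ WeakFlag c d x then 2 else 3

variable {T} {t : ι} {c d : Fin 4} {p : T.Realization}

theorem label_eq_zero (h : 2 * T.coordStat 2 p < T.coordStat 1 p) : T.label t c d p = 0 :=
  if_pos h

theorem label_eq_one (h : ¬ 2 * T.coordStat 2 p < T.coordStat 1 p)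
    (h' : 2 * T.coordStat 3 p < T.coordStat 2 p) : T.label t c d p = 1 := by
  rw [label, if_neg h, if_pos h']

theorem label_eq_two (h : ¬ 2 * T.coordStat 2 p < T.coordStat 1 p)
    (h' : ¬ 2 * T.coordStat 3 p < T.coordStat 2 p)
    (h'' : ∃ x, p = T.point t x ∧ WeakFlag c d x) : T.label t c d p = 2 := by
  rw [label, if_neg h, if_neg h', if_pos h'']

theorem label_ne_zero (h : ¬ 2 * T.coordStat 2 p < T.coordStat 1 p) : T.label t c d p ≠ 0 := by
  rw [label, if_neg h]
  split_ifs <;> decide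

theorem label_ne_one (h : ¬ 2 * T.coordStat 3 p < T.coordStat 2 p) : T.label t c d p ≠ 1 := by
  rw [label, if_neg h]
  split_ifs <;> decide

theorem label_ne_two (h : 2 * T.coordStat 3 p < T.coordStat 2 p) : T.label t c d p ≠ 2 := by
  rw [label, if_pos h]
  split_ifs <;> decide

theorem label_ne_two_of_not_exists (h : ¬ ∃ x, p = T.point t x ∧ WeakFlag c d x) :
    T.label t c d p ≠ 2 := by
  rw [label, if_neg h]
  split_ifs <;> decide

theorem label_ne_three (h : ∃ x, p = T.point t x ∧ WeakFlag c d x) : T.label t c d p ≠ 3 := by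
  rw [label, if_pos h]
  split_ifs <;> decide

/-- Near a point that is not a vertex, one of the labels `0, 1, 2` is missing, unless the point lies
in the given part of the given tetrahedron, where the label `3` is missing. -/
theorem eventually_label_ne (hcd : c ≠ d) (hp : p ∉ T.vertices) :
    (∃ a ≠ 3, ∀ᶠ q in 𝓝 p, T.label t c d q ≠ a) ∨
      (∃ x, p = T.point t x ∧ StrictFlag c d x) ∧ ∀ᶠ q in 𝓝 p, T.label t c d q ≠ 3 := by
  have hc := fun k => (T.continuous_coordStat k).continuousAt (x := p)
  rcases lt_trichotomy (2 * T.coordStat 2 p) (T.coordStat 1 p) with h | h | h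
  · refine Or.inl ⟨1, by decide, ?_⟩
    filter_upwards [((hc 2).const_mul 2).eventually_lt (hc 1) h] with q hq
    rw [label_eq_zero hq]; decide
  swap
  · refine Or.inl ⟨0, by decide, ?_⟩
    filter_upwards [(hc 1).eventually_lt ((hc 2).const_mul 2) h] with q hq
    exact label_ne_zero hq.not_gt
  rcases lt_trichotomy (2 * T.coordStat 3 p) (T.coordStat 2 p) with h' | h' | h'
  · refine Or.inl ⟨2, by decide, ?_⟩
    filter_upwards [((hc 3).const_mul 2).eventually_lt (hc 2) h'] with q hq
    exact label_ne_two hq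
  swap
  · refine Or.inl ⟨1, by decide, ?_⟩
    filter_upwards [(hc 2).eventually_lt ((hc 3).const_mul 2) h'] with q hq
    exact label_ne_one hq.not_gt
  rw [mem_vertices_iff] at hp
  obtain ⟨t', x, rfl⟩ := T.exists_eq_point p
  obtain ⟨σ, hσ⟩ := exists_perm_antitone x
  simp only [T.coordStat_point _ t' hσ] at h h' hp
  -- In the remaining case the decreasing coordinates satisfy x₁ = 2x₂ = 4x₃. Away from the vertices
  -- x₁ > 0, so the two smallest coordinates are strictly separated. This is the arc, one piece for
  -- each choice of the tetrahedron and these two coordinates.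
  have hx : StrictFlag (σ 2) (σ 3) x := by
    have h0 : 0 < x (σ 1) := lt_of_le_of_ne (stdSimplex.zero_le x _) (Ne.symm hp)
    have h10 : x (σ 1) ≤ x (σ 0) := hσ (by decide : (0 : Fin 4) ≤ 1)
    refine ⟨by linarith, by linarith, fun j h2 h3 => ?_⟩
    obtain ⟨k, rfl⟩ := σ.surjective j
    fin_cases k
    · change x (σ 2) < x (σ 0); linarith
    · change x (σ 2) < x (σ 1); linarith
    · exact (h2 rfl).elim
    · exact (h3 rfl).elim
  have hW := (T.isOpen_image_strictFlag t' (σ 2) (σ 3)).mem_nhds ⟨x, hx, rfl⟩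
  by_cases hf : t' = t ∧ σ 2 = c ∧ σ 3 = d
  · obtain ⟨rfl, rfl, rfl⟩ := hf
    refine Or.inr ⟨⟨x, rfl, hx⟩, ?_⟩
    filter_upwards [hW]
    rintro _ ⟨y, hy, rfl⟩
    exact label_ne_three ⟨y, rfl, hy.weakFlag⟩
  · refine Or.inl ⟨2, by decide, ?_⟩
    filter_upwards [hW]
    rintro _ ⟨y, hy, rfl⟩
    refine label_ne_two_of_not_exists ?_
    rintro ⟨z, hyz, hz⟩
    obtain ⟨rfl, h⟩ := Sigma.mk.inj (T.point_injective_of_pos hyz hy.weakFlag.pos)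
    obtain rfl := eq_of_heq h
    exact hf ⟨rfl, hy.eq_of_weakFlag hz hcd⟩

end FaceGluing

/-! ### The triangles of the dual spine. -/

namespace FaceGluing

open Topology Filter

variable {ι : Type v} (T : FaceGluing ι)

/-- The affine map of the triangle onto the triangle spanned by the barycenters of a tetrahedron,
its face opposite to `σ 3`, and its edge with endpoints `σ 0` and `σ 1`. -/
noncomputable def flagMap (σ : Equiv.Perm (Fin 4)) :
    C(stdSimplex ℝ (Fin 3), stdSimplex ℝ (Fin 4)) where
  toFun y := ⟨fun j => ![y 0 / 4 + y 1 / 3 + y 2 / 2, y 0 / 4 + y 1 / 3 + y 2 / 2,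
      y 0 / 4 + y 1 / 3, y 0 / 4] (σ.symm j), by
    have h0 := stdSimplex.zero_le y 0
    have h1 := stdSimplex.zero_le y 1
    have h2 := stdSimplex.zero_le y 2
    refine ⟨fun j => ?_, ?_⟩
    · beta_reduce
      generalize σ.symm j = i
      fin_cases i <;> simp <;> linarith
    · have h := stdSimplex.sum_eq_one y
      rw [Equiv.sum_comp σ.symm fun i => ![y 0 / 4 + y 1 / 3 + y 2 / 2,
        y 0 / 4 + y 1 / 3 + y 2 / 2, y 0 / 4 + y 1 / 3, y 0 / 4] i]
      rw [Fin.sum_univ_three] at h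
      simp only [Fin.sum_univ_four, Matrix.cons_val]
      linarith⟩
  continuous_toFun := by
    have h : ∀ i, Continuous fun y : stdSimplex ℝ (Fin 3) => y i := fun i =>
      (continuous_apply i).comp continuous_subtype_val
    refine Continuous.subtype_mk (continuous_pi fun j => ?_) _
    generalize σ.symm j = i
    fin_cases i
    · exact (((h 0).div_const 4).add ((h 1).div_const 3)).add ((h 2).div_const 2)
    · exact (((h 0).div_const 4).add ((h 1).div_const 3)).add ((h 2).div_const 2)
    · exact ((h 0).div_const 4).add ((h 1).div_const 3)
    · exact (h 0).div_const 4

section flagMap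

variable (σ : Equiv.Perm (Fin 4)) (y : stdSimplex ℝ (Fin 3))

theorem flagMap_apply (j : Fin 4) : flagMap σ y j = ![y 0 / 4 + y 1 / 3 + y 2 / 2,
    y 0 / 4 + y 1 / 3 + y 2 / 2, y 0 / 4 + y 1 / 3, y 0 / 4] (σ.symm j) := rfl

theorem flagMap_zero : flagMap σ y (σ 0) = y 0 / 4 + y 1 / 3 + y 2 / 2 := by
  simp [flagMap_apply]

theorem flagMap_one : flagMap σ y (σ 1) = y 0 / 4 + y 1 / 3 + y 2 / 2 := by
  simp [flagMap_apply]

theorem flagMap_two : flagMap σ y (σ 2) = y 0 / 4 + y 1 / 3 := by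
  simp [flagMap_apply]

theorem flagMap_three : flagMap σ y (σ 3) = y 0 / 4 := by
  simp [flagMap_apply]

theorem flagMap_mul (π : Equiv.Perm (Fin 4)) (j : Fin 4) :
    flagMap (π * σ) y (π j) = flagMap σ y j := by
  simp [flagMap_apply, Equiv.Perm.mul_def]

theorem antitone_flagMap : Antitone (flagMap σ y ∘ σ) := by
  have h0 := stdSimplex.zero_le y 0
  have h1 := stdSimplex.zero_le y 1
  have h2 := stdSimplex.zero_le y 2
  refine Fin.antitone_iff_succ_le.2 fun i => ?_
  fin_cases i
  · change flagMap σ y (σ 1) ≤ flagMap σ y (σ 0)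
    rw [flagMap_zero, flagMap_one]
  · change flagMap σ y (σ 2) ≤ flagMap σ y (σ 1)
    rw [flagMap_two, flagMap_one]; linarith
  · change flagMap σ y (σ 3) ≤ flagMap σ y (σ 2)
    rw [flagMap_two, flagMap_three]; linarith

theorem weakFlag_flagMap (hy : 0 < y 0) : WeakFlag (σ 2) (σ 3) (flagMap σ y) := by
  have h1 := stdSimplex.zero_le y 1
  have h2 := stdSimplex.zero_le y 2
  refine ⟨?_, ?_, fun j hc hd => ?_⟩
  · rw [flagMap_three]; linarith
  · rw [flagMap_three, flagMap_two]; linarith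
  · obtain ⟨k, rfl⟩ := σ.surjective j
    have hk : k ≤ 2 := by
      by_contra h
      exact hd (by rw [show k = 3 by omega])
    exact antitone_flagMap σ y hk

end flagMap

/-- The triangle of the dual spine spanned by the barycenters of a tetrahedron, its face opposite to
`σ 3`, and its edge with endpoints `σ 0` and `σ 1`. -/
noncomputable def flagTriangle (t : ι) (σ : Equiv.Perm (Fin 4)) :
    C(stdSimplex ℝ (Fin 3), T.Realization) :=
  ⟨fun y => T.point t (flagMap σ y), (T.continuous_point t).comp (flagMap σ).continuous⟩

variable (t : ι) (σ : Equiv.Perm (Fin 4))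

theorem coordStat_flagTriangle (k : Fin 4) (y : stdSimplex ℝ (Fin 3)) :
    T.coordStat k (T.flagTriangle t σ y) = flagMap σ y (σ k) :=
  T.coordStat_point k t (antitone_flagMap σ y)

theorem flagMap_one_pos (y : stdSimplex ℝ (Fin 3)) : 0 < flagMap σ y (σ 1) := by
  have h0 := stdSimplex.zero_le y 0
  have h1 := stdSimplex.zero_le y 1
  have h2 := stdSimplex.zero_le y 2
  have h := stdSimplex.sum_eq_one y
  rw [Fin.sum_univ_three] at h
  rw [flagMap_one]
  linarith

theorem flagTriangle_notMem_vertices (y : stdSimplex ℝ (Fin 3)) :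
    T.flagTriangle t σ y ∉ T.vertices := by
  rw [mem_vertices_iff, coordStat_flagTriangle]
  exact (flagMap_one_pos σ y).ne'

/-- The side opposite to the barycenter of the tetrahedron lies in a 2-face, where it is shared with
the adjacent tetrahedron. -/
theorem singularFace_zero_flagTriangle :
    (T.flagTriangle (T.nbr t (σ 3)) (T.perm t (σ 3) * σ)).singularFace 0 =
      (T.flagTriangle t σ).singularFace 0 := by
  ext z
  have h0 : (stdSimplex.map (Fin.succAbove (0 : Fin 3)) z) 0 = 0 := by
    simp [FunOnFinite.linearMap_apply_apply, Fin.succ_ne_zero]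
  refine (Quot.sound ⟨σ 3, ?_, rfl, fun j => flagMap_mul _ _ _ _⟩).symm
  change flagMap σ _ (σ 3) = 0
  rw [flagMap_three]
  change (stdSimplex.map (Fin.succAbove (0 : Fin 3)) z) 0 / 4 = 0
  rw [h0, zero_div]

/-- The side from the barycenter of the tetrahedron to that of the edge is shared by the two faces
containing the edge; exchanging 2 and 3 exchanges these faces. -/
theorem singularFace_one_flagTriangle :
    (T.flagTriangle t (σ * Equiv.swap 2 3)).singularFace 1 =
      (T.flagTriangle t σ).singularFace 1 := by
  ext z
  have h1 : (stdSimplex.map (Fin.succAbove (1 : Fin 3)) z) 1 = 0 := by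
    simp [FunOnFinite.linearMap_apply_apply, Fin.succAbove_ne]
  change T.point t (flagMap _ (stdSimplex.map (Fin.succAbove (1 : Fin 3)) z)) =
    T.point t (flagMap _ (stdSimplex.map (Fin.succAbove (1 : Fin 3)) z))
  generalize stdSimplex.map (Fin.succAbove (1 : Fin 3)) z = y at h1
  congr 1
  ext j
  obtain ⟨k, rfl⟩ := σ.surjective j
  simp only [flagMap_apply, h1, Equiv.Perm.mul_def, Equiv.symm_trans_apply, Equiv.symm_swap,
    Equiv.symm_apply_apply]
  fin_cases k
  · rw [Equiv.swap_apply_of_ne_of_ne (by decide) (by decide)]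
  · rw [Equiv.swap_apply_of_ne_of_ne (by decide) (by decide)]
  · simp
  · simp

/-- The side from the barycenter of the tetrahedron to that of the face is half of a dual 1-cell and
does not depend on the edge. -/
theorem singularFace_two_flagTriangle {σ τ : Equiv.Perm (Fin 4)} (h : σ 3 = τ 3) :
    (T.flagTriangle t σ).singularFace 2 = (T.flagTriangle t τ).singularFace 2 := by
  ext z
  have h2 : (stdSimplex.map (Fin.succAbove (2 : Fin 3)) z) 2 = 0 := by
    simp [FunOnFinite.linearMap_apply_apply, Fin.succAbove_ne]
  change T.point t (flagMap _ (stdSimplex.map (Fin.succAbove (2 : Fin 3)) z)) =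
    T.point t (flagMap _ (stdSimplex.map (Fin.succAbove (2 : Fin 3)) z))
  generalize stdSimplex.map (Fin.succAbove (2 : Fin 3)) z = y at h2
  have key : ∀ (σ : Equiv.Perm (Fin 4)) (j : Fin 4),
      flagMap σ y j = if j = σ 3 then y 0 / 4 else y 0 / 4 + y 1 / 3 := fun σ j => by
    obtain ⟨k, rfl⟩ := σ.surjective j
    simp only [flagMap_apply, h2, Equiv.symm_apply_apply, EmbeddingLike.apply_eq_iff_eq]
    fin_cases k <;> simp
  congr 1
  ext j
  rw [key, key, h]

/-- A triangle of the dual spine has one small triangle with labels `0, 1, 2` if it lies in the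
chosen part of the chosen tetrahedron. -/
theorem labelCount_flagTriangle (m : ℕ) :
    labelCount (T.label t (σ 2) (σ 3)) m (T.flagTriangle t σ) = -1 := by
  have hs := T.coordStat_flagTriangle t σ
  have hy : ∀ (y : stdSimplex ℝ (Fin 3)) i, 0 ≤ y i := fun y i => stdSimplex.zero_le y i
  have hsum : ∀ y : stdSimplex ℝ (Fin 3), y 0 + y 1 + y 2 = 1 := fun y => by
    rw [← Fin.sum_univ_three (fun i => y i)]; exact stdSimplex.sum_eq_one y
  rw [labelCount_eq]
  · have e2 : T.label t (σ 2) (σ 3) (T.flagTriangle t σ (stdSimplex.vertex 0)) = 2 := by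
      refine label_eq_two ?_ ?_ ⟨_, rfl, weakFlag_flagMap σ _ (by simp)⟩
      · rw [hs, hs, flagMap_two, flagMap_one]; simp
      · rw [hs, hs, flagMap_two, flagMap_three]; simp
    have e1 : T.label t (σ 2) (σ 3) (T.flagTriangle t σ (stdSimplex.vertex 1)) = 1 := by
      refine label_eq_one ?_ ?_
      · rw [hs, hs, flagMap_two, flagMap_one]; simp
      · rw [hs, hs, flagMap_two, flagMap_three]; simp
    have e0 : T.label t (σ 2) (σ 3) (T.flagTriangle t σ (stdSimplex.vertex 2)) = 0 := by
      refine label_eq_zero ?_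
      rw [hs, hs, flagMap_two, flagMap_one]; simp
    -- The vertices carry the labels 2, 1, 0 in this order, an odd arrangement, whence the sign -1.
    rw [e0, e1, e2]
    decide
  · intro y
    by_cases h : 0 < y 0
    · exact label_ne_three ⟨_, rfl, weakFlag_flagMap σ y h⟩
    · by_cases h1 : 2 * T.coordStat 2 (T.flagTriangle t σ y) < T.coordStat 1 (T.flagTriangle t σ y)
      · rw [label_eq_zero h1]; decide
      · have h2 : 2 * T.coordStat 3 (T.flagTriangle t σ y) <
            T.coordStat 2 (T.flagTriangle t σ y) := by
          rw [hs, hs, flagMap_two, flagMap_one] at h1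
          rw [hs, hs, flagMap_two, flagMap_three]
          linarith [hy y 0, hy y 1, hy y 2, hsum y]
        rw [label_eq_one h1 h2]; decide
  · intro i
    fin_cases i
    · refine ⟨2, by decide, fun y h => ?_⟩
      replace h : y 0 = 0 := h
      refine label_ne_two_of_not_exists ?_
      rintro ⟨x, hx, hf⟩
      obtain rfl := eq_of_heq (Sigma.mk.inj (T.point_injective_of_pos hx.symm hf.pos)).2
      have := hf.pos (σ 3)
      rw [flagMap_three, h] at this
      norm_num at this
    · refine ⟨1, by decide, fun y h => label_ne_one ?_⟩
      replace h : y 1 = 0 := h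
      rw [hs, hs, flagMap_two, flagMap_three, h]
      linarith [hy y 0]
    · refine ⟨0, by decide, fun y h => label_ne_zero ?_⟩
      replace h : y 2 = 0 := h
      rw [hs, hs, flagMap_two, flagMap_one, h]
      linarith [hy y 0, hy y 1]

/-- The only points without a locally missing label among 0, 1, 2 lie in the chosen strict flag,
which this triangle does not meet. -/
theorem eventually_labelCount_flagTriangle {t t' : ι} {c d : Fin 4} (hcd : c ≠ d)
    (h : ¬ (t' = t ∧ σ 2 = c ∧ σ 3 = d)) :
    ∃ m₀, ∀ m ≥ m₀, labelCount (T.label t c d) m (T.flagTriangle t' σ) = 0 := by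
  refine eventually_labelCount_eq_zero _ fun y => ?_
  rcases eventually_label_ne (t := t) hcd (T.flagTriangle_notMem_vertices t' σ y) with
    ⟨a, ha, H⟩ | ⟨⟨x, hx, hf⟩, -⟩
  · exact ⟨a, ha, (T.flagTriangle t' σ).continuous.continuousAt.eventually H⟩
  · exfalso
    obtain ⟨rfl, hx'⟩ := Sigma.mk.inj (T.point_injective_of_pos hx.symm hf.weakFlag.pos)
    obtain rfl := eq_of_heq hx'
    have h0 : 0 < y 0 := by
      have := hf.weakFlag.pos (σ 3)
      rw [flagMap_three] at this
      linarith
    obtain ⟨h2, h3⟩ := hf.eq_of_weakFlag (weakFlag_flagMap σ y h0)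
      (by simp)
    exact h ⟨rfl, h2.symm, h3.symm⟩

end FaceGluing

/-! ### Branchings as 2-chains on the spine. -/

namespace FaceGluing

variable {ι : Type v} {T : FaceGluing ι}

namespace Branching

theorem pos_self (b : T.Branching) (t : ι) (j : Fin 4) : ¬ b.pos t j j := by
  obtain ⟨ρ, hρ⟩ := b.exists_order t
  simp [hρ]

theorem pos_swap (b : T.Branching) (t : ι) {j k : Fin 4} (h : j ≠ k) :
    b.pos t k j ↔ ¬ b.pos t j k := by
  obtain ⟨ρ, hρ⟩ := b.exists_order t
  rw [hρ, hρ, not_lt, le_iff_lt_or_eq, or_iff_left fun e => h (ρ.injective e.symm)]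

open Classical in
/-- The indicator function of the oriented edges. -/
noncomputable def edgeIndicator (b : T.Branching) (t : ι) (j k : Fin 4) : ℤ :=
  if b.pos t j k then 1 else 0

theorem edgeIndicator_of_pos {b : T.Branching} {t : ι} {j k : Fin 4} (h : b.pos t j k) :
    b.edgeIndicator t j k = 1 := if_pos h

theorem edgeIndicator_of_not_pos {b : T.Branching} {t : ι} {j k : Fin 4} (h : ¬ b.pos t j k) :
    b.edgeIndicator t j k = 0 := if_neg h

theorem edgeIndicator_perm (b : T.Branching) (t : ι) {i j k : Fin 4} (hj : j ≠ i) (hk : k ≠ i) :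
    b.edgeIndicator (T.nbr t i) (T.perm t i j) (T.perm t i k) = b.edgeIndicator t j k := by
  classical
  exact if_congr (b.pos_perm t i j k hj hk) rfl rfl

theorem edgeIndicator_swap (b : T.Branching) (t : ι) {j k : Fin 4} (h : j ≠ k) :
    b.edgeIndicator t k j = 1 - b.edgeIndicator t j k := by
  by_cases hb : b.pos t j k
  · rw [edgeIndicator_of_pos hb, edgeIndicator_of_not_pos (by rwa [b.pos_swap t h, not_not]),
      sub_self]
  · rw [edgeIndicator_of_not_pos hb, edgeIndicator_of_pos (by rwa [b.pos_swap t h]), sub_zero]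

/-- The contribution to the dual edge of the face `(t, σ 3)` of the region dual to the edge with
endpoints `σ 0` and `σ 1`. -/
noncomputable def sign (b : T.Branching) (o : T.Orientation) (t : ι) (σ : Equiv.Perm (Fin 4)) : ℤ :=
  (o.sgn t * Equiv.Perm.sign σ : ℤˣ) * b.edgeIndicator t (σ 0) (σ 1)

theorem sum_sign (b : T.Branching) (o : T.Orientation) (t : ι) (i : Fin 4) :
    ∑ σ : Equiv.Perm (Fin 4) with σ 3 = i, b.sign o t σ =
      (b.inducing o 1 t i).ncard - (b.inducing o (-1) t i).ncard := by
  classical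
  have h : ∀ s, b.inducing o s t i = ((Finset.univ.filter fun σ : Equiv.Perm (Fin 4) => σ 3 = i ∧
      b.pos t (σ 0) (σ 1) ∧ o.sgn t * Equiv.Perm.sign σ = s : Finset _) : Set _) := fun s => by
    ext σ; simp [inducing]
  rw [h, h, Set.ncard_coe_finset, Set.ncard_coe_finset, Finset.card_filter, Finset.card_filter,
    Nat.cast_sum, Nat.cast_sum, ← Finset.sum_sub_distrib, Finset.sum_filter]
  refine Finset.sum_congr rfl fun σ _ => ?_
  by_cases h1 : σ 3 = i <;> by_cases h2 : b.pos t (σ 0) (σ 1) <;>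
    rcases Int.units_eq_one_or (o.sgn t * Equiv.Perm.sign σ) with h3 | h3 <;>
    simp [sign, edgeIndicator, h1, h2, h3]

/-- A total order excludes cyclically oriented faces, so the three contributions never all agree. -/
theorem ncard_inducing_mem (b : T.Branching) (o : T.Orientation) (t : ι) (i : Fin 4) :
    (b.inducing o (-1) t i).ncard = 1 ∨ (b.inducing o (-1) t i).ncard = 2 := by
  obtain ⟨ρ, hρ⟩ := b.exists_order t
  rw [b.ncard_inducing o _ t ρ hρ]
  generalize ρ i = k
  rcases Int.units_eq_one_or (-1 * o.sgn t * Equiv.Perm.sign ρ) with h | h <;> rw [h] <;>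
    revert k <;> decide

/-- Both boundary coefficients at the dual 1-cell are ±1, and ω determines the sign; hence they
cancel in the difference. -/
theorem sum_sign_eq {b b' : T.Branching} {o : T.Orientation}
    (h : b.toPreBranching o = b'.toPreBranching o) (t : ι) (i : Fin 4) :
    ∑ σ : Equiv.Perm (Fin 4) with σ 3 = i, (b.sign o t σ - b'.sign o t σ) = 0 := by
  have h1 : 2 ≤ (b.inducing o (-1) t i).ncard ↔ 2 ≤ (b'.inducing o (-1) t i).ncard :=
    iff_of_eq (congrFun₂ (congrArg PreBranching.out h) t i)
  have h2 := b.ncard_inducing_mem o t i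
  have h3 := b'.ncard_inducing_mem o t i
  have h4 := b.ncard_inducing_add o t i
  have h5 := b'.ncard_inducing_add o t i
  rw [Finset.sum_sub_distrib, sum_sign, sum_sign]
  omega

theorem sign_nbr (b : T.Branching) (o : T.Orientation) (t : ι) (σ : Equiv.Perm (Fin 4)) :
    b.sign o (T.nbr t (σ 3)) (T.perm t (σ 3) * σ) = - b.sign o t σ := by
  simp only [sign, Equiv.Perm.mul_apply, o.coherent, Equiv.Perm.sign_mul]
  rw [b.edgeIndicator_perm t (by simp) (by simp)]
  rcases Int.units_eq_one_or (Equiv.Perm.sign (T.perm t (σ 3))) with h' | h' <;> simp [h']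

theorem sign_swap_two_three (b : T.Branching) (o : T.Orientation) (t : ι)
    (σ : Equiv.Perm (Fin 4)) : b.sign o t (σ * Equiv.swap 2 3) = - b.sign o t σ := by
  have h0 : Equiv.swap (2 : Fin 4) 3 0 = 0 := by decide
  have h1 : Equiv.swap (2 : Fin 4) 3 1 = 1 := by decide
  simp only [sign, Equiv.Perm.mul_apply, h0, h1, Equiv.Perm.sign_mul,
    Equiv.Perm.sign_swap (by decide : (2 : Fin 4) ≠ 3)]
  simp

/-- Reversing the edge changes the sign of the permutation and replaces the indicator by 1 minus it.
The constant 1 drops out only in the difference of two branchings. -/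
theorem sign_swap_zero_one (b b' : T.Branching) (o : T.Orientation) (t : ι)
    (σ : Equiv.Perm (Fin 4)) :
    b.sign o t (σ * Equiv.swap 0 1) - b'.sign o t (σ * Equiv.swap 0 1) =
      b.sign o t σ - b'.sign o t σ := by
  simp only [sign, Equiv.Perm.mul_apply, Equiv.swap_apply_left, Equiv.swap_apply_right,
    Equiv.Perm.sign_mul, Equiv.Perm.sign_swap (by decide : (0 : Fin 4) ≠ 1)]
  rw [b.edgeIndicator_swap t (j := σ 0) (by simp), b'.edgeIndicator_swap t (j := σ 0) (by simp)]
  push_cast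
  ring

theorem eq_of_sign_eq {b b' : T.Branching} (o : T.Orientation)
    (h : ∀ t σ, b.sign o t σ - b'.sign o t σ = 0) : b = b' := by
  ext t j k
  by_cases hjk : j = k
  · subst hjk
    exact iff_of_false (b.pos_self t j) (b'.pos_self t j)
  · obtain ⟨σ, rfl, rfl⟩ : ∃ σ : Equiv.Perm (Fin 4), σ 0 = j ∧ σ 1 = k := by
      revert j k; decide
    have := h t σ
    by_cases h1 : b.pos t (σ 0) (σ 1) <;> by_cases h2 : b'.pos t (σ 0) (σ 1) <;>
      simp [sign, edgeIndicator, h1, h2] at this ⊢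

end Branching

/-- The triangles of the dual spine, weighted by the contributions of the two branchings to the
dual edges, form a cycle. -/
theorem sum_singularFace_eq_zero [Fintype ι] {X : Type*} [TopologicalSpace X]
    {s : ι → Equiv.Perm (Fin 4) → C(stdSimplex ℝ (Fin 3), X)}
    (h0 : ∀ t σ, (s (T.nbr t (σ 3)) (T.perm t (σ 3) * σ)).singularFace 0 = (s t σ).singularFace 0)
    (h1 : ∀ t σ, (s t (σ * Equiv.swap 2 3)).singularFace 1 = (s t σ).singularFace 1)
    (h2 : ∀ t σ τ, σ 3 = τ 3 → (s t σ).singularFace 2 = (s t τ).singularFace 2)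
    {w : ι → Equiv.Perm (Fin 4) → ℤ}
    (w0 : ∀ t σ, w (T.nbr t (σ 3)) (T.perm t (σ 3) * σ) = - w t σ)
    (w1 : ∀ t σ, w t (σ * Equiv.swap 2 3) = - w t σ)
    (w2 : ∀ t i, ∑ σ : Equiv.Perm (Fin 4) with σ 3 = i, w t σ = 0)
    {A : Type*} [AddCommGroup A] (f : C(stdSimplex ℝ (Fin 2), X) → A) :
    ∑ j : ι × Equiv.Perm (Fin 4),
      w j.1 j.2 • ∑ i : Fin 3, (-1 : ℤ) ^ (i : ℕ) • f ((s j.1 j.2).singularFace i) = 0 := by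
  have e : ∀ j : ι × Equiv.Perm (Fin 4),
      w j.1 j.2 • ∑ i : Fin 3, (-1 : ℤ) ^ (i : ℕ) • f ((s j.1 j.2).singularFace i) =
        w j.1 j.2 • f ((s j.1 j.2).singularFace 0) - w j.1 j.2 • f ((s j.1 j.2).singularFace 1) +
          w j.1 j.2 • f ((s j.1 j.2).singularFace 2) := fun j => by
    simp only [Fin.sum_univ_three, Fin.val_zero, Fin.val_one, Fin.val_two, pow_zero, pow_one,
      one_smul, neg_smul, neg_one_sq, smul_add, smul_neg, sub_eq_add_neg]
  -- Sides inside 2-faces cancel in pairs across the gluing; `ne_self` ensures that the pairing has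
  -- no fixed point.
  have s0 : ∑ j : ι × Equiv.Perm (Fin 4), w j.1 j.2 • f ((s j.1 j.2).singularFace 0) = 0 := by
    refine Finset.sum_involution
      (fun j _ => (T.nbr j.1 (j.2 3), T.perm j.1 (j.2 3) * j.2)) ?_ ?_ ?_ ?_
    · rintro ⟨t, σ⟩ -
      simp only [w0, h0, neg_smul, add_neg_cancel]
    · rintro ⟨t, σ⟩ - - h
      obtain ⟨h3, h4⟩ := Prod.mk.inj h
      exact T.ne_self t (σ 3) (Prod.ext h3 (Equiv.congr_fun h4 3))
    · simp
    · rintro ⟨t, σ⟩ -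
      simp only [Equiv.Perm.mul_apply, T.nbr_nbr, T.perm_perm, inv_mul_cancel_left]
  have s1 : ∑ j : ι × Equiv.Perm (Fin 4), w j.1 j.2 • f ((s j.1 j.2).singularFace 1) = 0 := by
    refine Finset.sum_involution (fun j _ => (j.1, j.2 * Equiv.swap 2 3)) ?_ ?_ ?_ ?_
    · rintro ⟨t, σ⟩ -
      simp only [w1, h1, neg_smul, add_neg_cancel]
    · rintro ⟨t, σ⟩ - - h
      have := σ.injective (Equiv.congr_fun (Prod.mk.inj h).2 2)
      revert this; decide
    · simp
    · rintro ⟨t, σ⟩ -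
      simp [mul_assoc]
  -- Sides on the dual 1-cells are collected over the edges of the face, where the weights add up to
  -- the boundary coefficient.
  have s2 : ∑ j : ι × Equiv.Perm (Fin 4), w j.1 j.2 • f ((s j.1 j.2).singularFace 2) = 0 := by
    rw [Fintype.sum_prod_type]
    refine Finset.sum_eq_zero fun t _ => ?_
    rw [← Finset.sum_fiberwise Finset.univ (fun σ : Equiv.Perm (Fin 4) => σ 3)]
    refine Finset.sum_eq_zero fun i _ => ?_
    obtain ⟨τ, rfl⟩ : ∃ τ : Equiv.Perm (Fin 4), τ 3 = i := ⟨Equiv.swap 3 i, by simp⟩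
    rw [Finset.sum_congr rfl fun σ hσ => by rw [h2 t σ τ (Finset.mem_filter.1 hσ).2],
      ← Finset.sum_smul, w2, zero_smul]
  rw [Finset.sum_congr rfl fun j _ => e j, Finset.sum_add_distrib, Finset.sum_sub_distrib, s0, s1,
    s2, sub_zero, add_zero]

end FaceGluing

/-! ### Lifting from the polyhedron to the manifold. -/

namespace IdealTriangulation

open Topology Filter

variable {M : Type u} [TopologicalSpace M] [ChartedSpace (EuclideanHalfSpace 3) M]
  {ι : Type v} (T : IdealTriangulation M ι)

/-- The map of the manifold to the polyhedron that collapses the boundary components. -/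
def collapse (x : M) : T.gluing.Realization := T.homeo.symm (Quotient.mk (boundarySetoid M) x)

theorem continuous_collapse : Continuous T.collapse :=
  T.homeo.symm.continuous.comp continuous_quotient_mk'

theorem collapse_mem_vertices_iff (x : M) :
    T.collapse x ∈ T.gluing.vertices ↔ x ∉ (𝓡∂ 3).interior M := by
  have h : T.collapse x ∈ T.gluing.vertices ↔
      Quotient.mk (boundarySetoid M) x ∈ collapsedPoints M := by
    rw [← T.image_vertices]
    constructor
    · exact fun h => ⟨_, h, T.homeo.apply_symm_apply _⟩
    · rintro ⟨p, hp, hpx⟩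
      rw [collapse, ← hpx, T.homeo.symm_apply_apply]
      exact hp
  rw [h, ← Set.mem_compl_iff, ModelWithCorners.compl_interior]
  constructor
  · rintro ⟨y, hy, hyx⟩
    rcases Quotient.exact hyx with e | ⟨-, hx, -⟩
    · rwa [← e]
    · exact hx
  · exact fun hx => ⟨x, hx, rfl⟩

theorem collapse_injOn : Set.InjOn T.collapse ((𝓡∂ 3).interior M) := by
  intro x hx y _ h
  rcases Quotient.exact (T.homeo.symm.injective h) with e | ⟨hb, -, -⟩
  · exact e
  · rw [← ModelWithCorners.compl_interior] at hb
    exact (hb hx).elim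

/-- Collapsing identifies no interior point with another point, so open subsets of the interior are
saturated. -/
theorem isOpenEmbedding_collapse [IsManifold (𝓡∂ 3) ∞ M] :
    IsOpenEmbedding fun x : (𝓡∂ 3).interior M => T.collapse x := by
  refine IsOpenEmbedding.of_continuous_injective_isOpenMap
    (T.continuous_collapse.comp continuous_subtype_val)
    (fun x y h => Subtype.ext (T.collapse_injOn x.2 y.2 h)) fun U hU => ?_
  have hV : IsOpen (Subtype.val '' U : Set M) :=
    (ModelWithCorners.isOpen_interior (n := ∞) (by simp)).isOpenMap_subtype_val U hU
  have hQ : IsOpen (Quotient.mk (boundarySetoid M) '' (Subtype.val '' U)) := by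
    refine (isQuotientMap_quotient_mk' (s := boundarySetoid M)).isOpen_preimage.1 ?_
    convert hV using 1
    refine Set.Subset.antisymm ?_ (Set.subset_preimage_image _ _)
    rintro x ⟨y, hy, hyx⟩
    rcases Quotient.exact hyx with e | ⟨hb, -, -⟩
    · rwa [← e]
    · obtain ⟨z, -, rfl⟩ := hy
      rw [← ModelWithCorners.compl_interior] at hb
      exact (hb z.2).elim
  have hi : (fun x : (𝓡∂ 3).interior M => T.collapse x) '' U =
      T.homeo.symm '' (Quotient.mk (boundarySetoid M) '' (Subtype.val '' U)) :=
    Set.ext fun p => ⟨fun ⟨x, hx, e⟩ => ⟨_, ⟨_, ⟨x, hx, rfl⟩, rfl⟩, e⟩,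
      fun ⟨_, ⟨_, ⟨x, hx, e'⟩, e''⟩, e⟩ => ⟨x, hx, by subst e'; subst e''; exact e⟩⟩
  rw [hi]
  exact T.homeo.symm.isOpenMap _ hQ

theorem exists_collapse_eq {p : T.gluing.Realization} (hp : p ∉ T.gluing.vertices) :
    ∃ x : (𝓡∂ 3).interior M, T.collapse x = p := by
  obtain ⟨x, hx⟩ := Quotient.exists_rep (s := boundarySetoid M) (T.homeo p)
  have h : T.collapse x = p := by
    rw [collapse, hx, T.homeo.symm_apply_apply]
  refine ⟨⟨x, ?_⟩, h⟩
  by_contra hx'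
  exact hp (h ▸ (T.collapse_mem_vertices_iff x).2 hx')

/-- Maps to the complement of the vertices can be lifted to the interior of the manifold. -/
theorem exists_lift [IsManifold (𝓡∂ 3) ∞ M] {Y : Type*} [TopologicalSpace Y]
    (s : C(Y, T.gluing.Realization)) (hs : ∀ y, s y ∉ T.gluing.vertices) :
    ∃ s' : C(Y, M), ∀ y, s' y ∈ (𝓡∂ 3).interior M ∧ T.collapse (s' y) = s y := by
  choose g hg using fun y => T.exists_collapse_eq (hs y)
  have hgc : Continuous g := by
    rw [T.isOpenEmbedding_collapse.continuous_iff]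
    exact s.continuous.congr fun y => (hg y).symm
  exact ⟨⟨fun y => g y, continuous_subtype_val.comp hgc⟩, fun y => ⟨(g y).2, hg y⟩⟩

end IdealTriangulation

/-! ### Reading off the coefficients of the cycle. -/

theorem perm_eq_or_of_apply_eq {σ τ : Equiv.Perm (Fin 4)} (h2 : σ 2 = τ 2) (h3 : σ 3 = τ 3) :
    σ = τ ∨ σ = τ * Equiv.swap 0 1 := by
  have h : ∀ ρ : Equiv.Perm (Fin 4), ρ 2 = 2 → ρ 3 = 3 → ρ = 1 ∨ ρ = Equiv.swap 0 1 := by decide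
  rcases h (τ⁻¹ * σ) (by simp [h2]) (by simp [h3]) with e | e
  · exact Or.inl (by rw [← mul_one τ, ← e, mul_inv_cancel_left])
  · exact Or.inr (by rw [← e, mul_inv_cancel_left])

theorem mainTheorem7 {M : Type u} [TopologicalSpace M] [T2Space M] [CompactSpace M]
    [ConnectedSpace M] [ChartedSpace (EuclideanHalfSpace 3) M] [IsManifold (𝓡∂ 3) ∞ M]
    (hM : ((𝓡∂ 3).boundary M).Nonempty)
    (hH : IsZero (integralHomology 2 M))
    {ι : Type v} [Finite ι] (T : IdealTriangulation M ι) (o : T.gluing.Orientation)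
    (b b' : T.gluing.Branching) (hω : b.toPreBranching o = b'.toPreBranching o) :
    b = b' := by
  classical
  have := Fintype.ofFinite ι
  refine FaceGluing.Branching.eq_of_sign_eq o fun t₀ σ₀ => ?_
  have hcd : σ₀ 2 ≠ σ₀ 3 := by simp
  set w : ι → Equiv.Perm (Fin 4) → ℤ := fun t σ => b.sign o t σ - b'.sign o t σ with hw
  change w t₀ σ₀ = 0
  choose s hs' hs using fun t σ => T.exists_lift (T.gluing.flagTriangle t σ)
    (T.gluing.flagTriangle_notMem_vertices t σ)
  have hface : ∀ (i : Fin 3) (t t' : ι) (σ σ' : Equiv.Perm (Fin 4)),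
      (T.gluing.flagTriangle t σ).singularFace i = (T.gluing.flagTriangle t' σ').singularFace i →
      (s t σ).singularFace i = (s t' σ').singularFace i := fun i t t' σ σ' h => by
    ext z
    refine T.collapse_injOn (hs' _ _ _) (hs' _ _ _) ?_
    exact (hs _ _ _).trans ((DFunLike.congr_fun h z).trans (hs _ _ _).symm)
  obtain ⟨h, hK, hi⟩ := exists_continuousMap_interior (n := 3) (M := M)
    (K := ⋃ j : ι × Equiv.Perm (Fin 4), Set.range (s j.1 j.2))
    (isClosed_iUnion_of_finite fun j => (isCompact_range (s j.1 j.2).continuous).isClosed)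
    (Set.iUnion_subset fun j => Set.range_subset_iff.2 fun y => hs' _ _ y)
  have hsh : ∀ t σ y, h (s t σ y) = s t σ y := fun t σ y =>
    hK _ (Set.mem_iUnion.2 ⟨(t, σ), y, rfl⟩)
  set L := T.gluing.label t₀ (σ₀ 2) (σ₀ 3) with hL
  -- Precomposing with `h` keeps the collapsed image away from the vertices, the only points where
  -- the labelling may lack a locally missing label; on the triangles of the cycle `h` is the
  -- identity.
  set ℓ : M → Fin 4 := fun x => L (T.collapse (h x)) with hℓ
  have hloc : ∀ x, ∃ a, ∀ᶠ y in nhds x, ℓ y ≠ a := fun x => by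
    have hx : T.collapse (h x) ∉ T.gluing.vertices := fun h' =>
      (T.collapse_mem_vertices_iff _).1 h' (hi x)
    have hc : ContinuousAt (fun x => T.collapse (h x)) x :=
      (T.continuous_collapse.comp h.continuous).continuousAt
    rcases FaceGluing.eventually_label_ne (t := t₀) hcd hx with ⟨a, -, ha⟩ | ⟨-, ha⟩
    · exact ⟨a, hc.eventually ha⟩
    · exact ⟨3, hc.eventually ha⟩
  have hcount : ∀ m t σ, labelCount ℓ m (s t σ) = labelCount L m (T.gluing.flagTriangle t σ) :=
    fun m t σ => by simp only [labelCount, hℓ, hsh, hs]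
  obtain ⟨m₁, h₁⟩ := eventually_sum_labelCount_eq_zero hH hloc
    (fun j : ι × Equiv.Perm (Fin 4) => s j.1 j.2) (fun j => w j.1 j.2)
    (FaceGluing.sum_singularFace_eq_zero
      (fun t σ => hface 0 _ _ _ _ (T.gluing.singularFace_zero_flagTriangle t σ))
      (fun t σ => hface 1 _ _ _ _ (T.gluing.singularFace_one_flagTriangle t σ))
      (fun t σ τ e => hface 2 _ _ _ _ (T.gluing.singularFace_two_flagTriangle t e))
      (fun t σ => by simp only [FaceGluing.Branching.sign_nbr]; ring)
      (fun t σ => by simp only [FaceGluing.Branching.sign_swap_two_three]; ring)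
      (FaceGluing.Branching.sum_sign_eq hω))
  have hj : ∀ j : ι × Equiv.Perm (Fin 4), ∃ m₀, ∀ m ≥ m₀, w j.1 j.2 * labelCount ℓ m (s j.1 j.2) =
      if j.1 = t₀ ∧ j.2 2 = σ₀ 2 ∧ j.2 3 = σ₀ 3 then - w t₀ σ₀ else 0 := by
    rintro ⟨t, σ⟩
    by_cases hf : t = t₀ ∧ σ 2 = σ₀ 2 ∧ σ 3 = σ₀ 3
    · refine ⟨0, fun m _ => ?_⟩
      rw [if_pos hf, hcount]
      obtain ⟨rfl, h2, h3⟩ := hf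
      have hwσ : w t σ = w t σ₀ := by
        rcases perm_eq_or_of_apply_eq h2 h3 with rfl | rfl
        · rfl
        · exact FaceGluing.Branching.sign_swap_zero_one b b' o t σ₀
      rw [hL, ← h2, ← h3, FaceGluing.labelCount_flagTriangle, hwσ, mul_neg_one]
    · obtain ⟨m₀, h₀⟩ := T.gluing.eventually_labelCount_flagTriangle σ hcd hf
      refine ⟨m₀, fun m hm => ?_⟩
      rw [if_neg hf, hcount, h₀ m hm, mul_zero]
  choose m₂ h₂ using hj
  -- One depth of subdivision that suffices for the bounding chain and for each of the finitely many
  -- triangles.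
  have h₃ := h₁ (max m₁ (Finset.univ.sup m₂)) (le_max_left _ _)
  rw [Finset.sum_congr rfl fun j _ => h₂ j _ ((Finset.le_sup (Finset.mem_univ j)).trans
    (le_max_right _ _)), ← Finset.sum_filter, Finset.sum_const, smul_neg, neg_eq_zero,
    smul_eq_zero] at h₃
  -- All surviving terms equal `- w t₀ σ₀`, and there is at least one of them, so a nonzero multiple
  -- of the weight vanishes.
  refine h₃.resolve_left (Finset.card_ne_zero.2 ⟨(t₀, σ₀), ?_⟩)
  simp
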